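/- Let $\varrho\colon\mathbb R^n\times\mathbb R^n\to\mathbb R$ be a distance function, i.e. (D1) $\varrho(a,b)\ge 0$, with equality iff $a=b$; (D2) $\varrho(a,b)=\varrho(b,a)$; (D3) $\varrho(a,b)\le\varrho(a,c)+\varrho(c,b)$. Put $S_a(r)=\{q:\varrho(a,q)=r\}$, and call $\{q:\varrho(a,q)\le r\}$ the distance ball with centre $a$ and radius $r>0$. For a curve $x\colon[\alpha,\beta]\to\mathbb R^n$ the distance arc length is $s_D(x)=\lim\sum_i\varrho(x(t_i),x(t_{i+1}))\in[0,\infty]$, the limit over subdivisions $\alpha=t_0\le\dots\le t_N=\beta$ as the mesh tends to $0$. Further conditions on $\varrho$: (D4) $\varrho$ is continuous, and $C^\infty$ off the diagonal. (D5) (a) For $r>0$ the distance spheres are strictly convex ($S_a(r)$ is the boundary of the open ball $\{\varrho(a,\cdot)<r\}$, and the closed ball is strictly convex); (b) they have everywhere positive Gauss curvature (with respect to the inner normal); (c) for each $p$ there is a diffeomorphism $\mathbb R^n\setminus\{p\}\to\mathbb R^n\setminus\{0\}$ that takes $S_p(r)$ to the Euclidean sphere of radius $r$ about $0$ for every $r>0$;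 (d) if $a\ne b$ and the distance ball with centre $a$ and radius $r$ contains the one with centre $b$ and radius $\bar r$, then $S_a(r)$ and $S_b(\bar r)$ have at most one common point $p$, and in each common tangent direction at $p$ the normal curvature of $S_a(r)$ is smaller than that of $S_b(\bar r)$. For $a\neq b$, the osculation curve $o(r)=o(r;a,b)$, $r\in\mathbb R$, is given, for $r\ge0$, by: $o(r)$ is the point of $S_a(r)$ with $\varrho(\cdot,b)$ minimal, and $o(-r)$ is the point of $S_a(r)$ with $\varrho(\cdot,b)$ maximal. It is a quasigeodesic $q(r;a,b)$ if any two distinct points of it generate the same osculation curve (as a point set); its arc from $a$ to $b$, $0\le r\le\varrho(a,b)$, is $q[a,b]$. (D6) Every osculation curve is a quasigeodesic. (D7) In all coordinate systems $(x,x+ry)\mapsto(x,\varphi(y),r)$ on $\{(x,x'):x\ne x'\}$, where $r>0$ and $\varphi$ are local coordinates on the Euclidean unit sphere $S^{n-1}\ni y$, all partial derivatives (of every order) of $\varrho/r$ are locally bounded near $r=0$. The induced weak Finsler space is $F^n=(\mathbb R^n,\mathcal F)$ with $\mathcal F(x,y)=\lim_{r\to0^+}\frac1r\varrho(x,x+ry)$;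 its Finsler distance $\varrho^F(a,b)$ is the infimum of $\int_\alpha^\beta\mathcal F(x,\dot x)\,dt$ over the piecewise $C^1$ curves $x\colon[\alpha,\beta]\to\mathbb R^n$ from $a$ to $b$, and a curve that attains this infimum is a (minimizing) geodesic. **Theorem.** (a) If $\varrho$ satisfies (D1)–(D3), then every curve $x$ from $a$ to $b$ whose distance arc length exists satisfies $s_D(x)\ge\varrho(a,b)$. If moreover (D4) holds, then $s_D(x)\in[0,\infty]$ exists for every continuous curve $x$, and the inequality is strict in general: for $n\ge1$ any points $a,b$ are joined by a $C^\infty$ curve with $s_D(x)>\varrho(a,b)$. (b) Let $\varrho$ satisfy (D1)–(D7), and suppose that any two points $a,b$ are joined by a geodesic of the induced weak Finsler space $F^n$. Then $\varrho=\varrho^F$ if and only if $s_D(q[a,b])=\varrho(a,b)$ for every quasigeodesic $q[a,b]$. -/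

import Mathlib

open Set Filter Topology
open scoped ContDiff ENNReal

noncomputable section

namespace DistSpace

/-- The Euclidean space `ℝⁿ`. -/
abbrev E (n : ℕ) : Type := EuclideanSpace ℝ (Fin n)

variable {n : ℕ}

/-! ### Distance functions and their spheres -/

def D1 (ρ : E n → E n → ℝ) : Prop :=
  ∀ a b, 0 ≤ ρ a b ∧ (ρ a b = 0 ↔ a = b)

def D2 (ρ : E n → E n → ℝ) : Prop :=
  ∀ a b, ρ a b = ρ b a

def D3 (ρ : E n → E n → ℝ) : Prop :=
  ∀ a b c, ρ a b ≤ ρ a c + ρ c b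

/-- `ρ` is continuous, and smooth off the diagonal. -/
def D4 (ρ : E n → E n → ℝ) : Prop :=
  Continuous (fun z : E n × E n => ρ z.1 z.2) ∧
    ContDiffOn ℝ ∞ (fun z : E n × E n => ρ z.1 z.2) {z | z.1 ≠ z.2}

/-- The distance sphere `S_a(r)`. -/
def sph (ρ : E n → E n → ℝ) (a : E n) (r : ℝ) : Set (E n) := {q | ρ a q = r}

/-- The closed distance ball. -/
def cball (ρ : E n → E n → ℝ) (a : E n) (r : ℝ) : Set (E n) := {q | ρ a q ≤ r}

/-- The open distance ball. -/
def oball (ρ : E n → E n → ℝ) (a : E n) (r : ℝ) : Set (E n) := {q | ρ a q < r}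

/-! ### Curvature of the level hypersurfaces of a function -/

/-- The tangent space at `p` of the level hypersurface of `f` through `p`, i.e. the
orthogonal complement of the gradient. -/
def tangent (f : E n → ℝ) (p : E n) : Submodule ℝ (E n) :=
  (Submodule.span ℝ {gradient f p})ᗮ

/-- The shape operator at `p` of the level hypersurface of `f` through `p`, with respect to the
unit normal `-∇f/‖∇f‖` (the inner normal of the sublevel set): the tangential part of
`v ↦ D_v ∇f / ‖∇f‖`. -/
def shapeOperator (f : E n → ℝ) (p : E n) : tangent f p →ₗ[ℝ] tangent f p :=
  ‖gradient f p‖⁻¹ •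
    ((tangent f p).orthogonalProjectionOnto ∘L fderiv ℝ (gradient f) p ∘L
      (tangent f p).subtypeL).toLinearMap

/-- The Gauss curvature: the product of the principal curvatures. -/
def gaussCurvature (f : E n → ℝ) (p : E n) : ℝ := LinearMap.det (shapeOperator f p)

/-- The normal curvature in the direction of a tangent vector `v ≠ 0`, with respect to the same
normal. -/
def normalCurvature (f : E n → ℝ) (p v : E n) : ℝ :=
  inner ℝ (fderiv ℝ (gradient f) p v) v / (‖gradient f p‖ * ‖v‖ ^ 2)

/-- Distance spheres are strictly convex: `S_a(r)` bounds the open distance ball, and the closed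
distance ball is a strictly convex set. -/
def D5a (ρ : E n → E n → ℝ) : Prop :=
  ∀ a r, 0 < r → frontier (oball ρ a r) = sph ρ a r ∧ StrictConvex ℝ (cball ρ a r)

/-- Distance spheres have everywhere positive Gauss curvature. -/
def D5b (ρ : E n → E n → ℝ) : Prop :=
  ∀ a r, 0 < r → ∀ p ∈ sph ρ a r, 0 < gaussCurvature (ρ a) p

/-- For each `p`, the family `S_p(r)`, `r > 0`, is diffeomorphic to the family of the Euclidean
spheres about `0`: a diffeomorphism `ℝⁿ ∖ {p} → ℝⁿ ∖ {0}` takes `S_p(r)` to the Euclidean sphere of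
radius `r`, for all `r > 0`. -/
def D5c (ρ : E n → E n → ℝ) : Prop :=
  ∀ p, ∃ Φ Ψ : E n → E n,
    MapsTo Φ {p}ᶜ {0}ᶜ ∧ MapsTo Ψ {0}ᶜ {p}ᶜ ∧ InvOn Ψ Φ {p}ᶜ {0}ᶜ ∧
    ContDiffOn ℝ ∞ Φ {p}ᶜ ∧ ContDiffOn ℝ ∞ Ψ {0}ᶜ ∧
    ∀ r, 0 < r → Φ '' sph ρ p r = Metric.sphere 0 r

/-- If a distance ball contains another one, with another centre, then their spheres touch in at
most one point, and there the normal curvatures of the outer sphere are the smaller ones. -/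
def D5d (ρ : E n → E n → ℝ) : Prop :=
  ∀ a b r s, 0 < r → 0 < s → a ≠ b → cball ρ b s ⊆ cball ρ a r →
    (sph ρ a r ∩ sph ρ b s).Subsingleton ∧
    ∀ p ∈ sph ρ a r ∩ sph ρ b s, ∀ v, v ≠ 0 → v ∈ tangent (ρ a) p → v ∈ tangent (ρ b) p →
      normalCurvature (ρ a) p v < normalCurvature (ρ b) p v

/-! ### Osculation curves and quasigeodesics -/

/-- `o` is the osculation curve `o(r; a, b)`, `r ∈ ℝ`: for `r ≥ 0`, `o r` is the point of `S_a(r)`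
nearest to `b`, and `o (-r)` is the point of `S_a(r)` furthest from `b`. -/
def IsOscCurve (ρ : E n → E n → ℝ) (a b : E n) (o : ℝ → E n) : Prop :=
  (∀ r, 0 ≤ r → o r ∈ sph ρ a r ∧ IsMinOn (fun p => ρ p b) (sph ρ a r) (o r)) ∧
  (∀ r, 0 ≤ r → o (-r) ∈ sph ρ a r ∧ IsMaxOn (fun p => ρ p b) (sph ρ a r) (o (-r)))

/-- `q` is a quasigeodesic with generator points `a` and `b`: an osculation curve such that any two
of its points generate the same osculation curve (as a point set). -/
def IsQuasigeodesic (ρ : E n → E n → ℝ) (a b : E n) (q : ℝ → E n) : Prop :=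
  a ≠ b ∧ IsOscCurve ρ a b q ∧
    ∀ a' ∈ range q, ∀ b' ∈ range q, a' ≠ b' →
      ∀ o, IsOscCurve ρ a' b' o → range o = range q

/-- Any two points of an osculation curve generate the same osculation curve. -/
def D6 (ρ : E n → E n → ℝ) : Prop :=
  ∀ a b, a ≠ b → ∀ o, IsOscCurve ρ a b o →
    ∀ a' ∈ range o, ∀ b' ∈ range o, a' ≠ b' →
      ∀ o', IsOscCurve ρ a' b' o' → range o' = range o

/-- In all coordinate systems `(x, x + r y) ↦ (x, φ(y), r)`, where `φ` are local coordinates on the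
Euclidean unit sphere (with inverse `ψ : V → Sⁿ⁻¹`), all partial derivatives of `ρ / r` of all
orders are bounded near the diagonal `r = 0`, locally in `x` and `φ`. -/
def D7 (ρ : E n → E n → ℝ) : Prop :=
  ∀ (V : Set (E (n - 1))) (ψ : E (n - 1) → E n), IsOpen V → ContDiffOn ℝ ∞ ψ V →
    (∀ u ∈ V, ‖ψ u‖ = 1) → InjOn ψ V → (∀ u ∈ V, Function.Injective (fderiv ℝ ψ u)) →
    ∀ (k : ℕ) (x₀ : E n), ∀ u₀ ∈ V, ∃ C : ℝ,
      ∀ᶠ z in 𝓝[{z : E n × E (n - 1) × ℝ | 0 < z.2.2}] (x₀, u₀, (0 : ℝ)),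
        ‖iteratedFDeriv ℝ k
          (fun z : E n × E (n - 1) × ℝ => ρ z.1 (z.1 + z.2.2 • ψ z.2.1) / z.2.2) z‖ ≤ C

/-! ### Distance arc length -/

/-- `s_D(x) = L` for the curve `x` on `[α, β]`: the sums `∑ ρ(x(tᵢ), x(tᵢ₊₁))` over the subdivisions
`α = t₀ ≤ ⋯ ≤ t_N = β` converge to `L ∈ [0, ∞]` as the mesh tends to `0`. -/
def HasDistLength (ρ : E n → E n → ℝ) (x : ℝ → E n) (α β : ℝ) (L : ℝ≥0∞) : Prop :=
  ∀ U ∈ 𝓝 L, ∃ δ > 0, ∀ (N : ℕ) (t : ℕ → ℝ), Monotone t → t 0 = α → t N = β →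
    (∀ i < N, t (i + 1) - t i < δ) →
      ENNReal.ofReal (∑ i ∈ Finset.range N, ρ (x (t i)) (x (t (i + 1)))) ∈ U

/-! ### The induced weak Finsler space -/

/-- `F(x, y) = lim_{r → 0⁺} ρ(x, x + r y) / r`. -/
def inducedF (ρ : E n → E n → ℝ) (x y : E n) : ℝ :=
  limUnder (𝓝[>] (0 : ℝ)) (fun r => ρ x (x + r • y) / r)

/-- Piecewise `C¹` curves on `[α, β]`: continuous, and `C¹` on all closed subintervals that contain
none of finitely many break points in their interior. -/
def IsPiecewiseC1 (x : ℝ → E n) (α β : ℝ) : Prop :=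
  ContinuousOn x (Icc α β) ∧ ∃ s : Finset ℝ, ∀ u v, α ≤ u → u < v → v ≤ β →
    (∀ t ∈ s, t ∉ Ioo u v) → ContDiffOn ℝ 1 x (Icc u v)

/-- The Finsler arc length `s_F(x) = ∫ F(x, ẋ) dt`. -/
def finslerLength (F : E n → E n → ℝ) (x : ℝ → E n) (α β : ℝ) : ℝ :=
  ∫ t in α..β, F (x t) (deriv x t)

/-- `x` on `[α, β]` is a piecewise `C¹` curve from `a` to `b`. -/
def Connects (x : ℝ → E n) (α β : ℝ) (a b : E n) : Prop :=
  α < β ∧ IsPiecewiseC1 x α β ∧ x α = a ∧ x β = b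

/-- The Finsler distance: the infimum of the lengths of the curves from `a` to `b`. -/
def finslerDist (F : E n → E n → ℝ) (a b : E n) : ℝ :=
  sInf {l | ∃ (x : ℝ → E n) (α β : ℝ), Connects x α β a b ∧ l = finslerLength F x α β}

/-- Any two points are joined by a minimizing geodesic. -/
def HasGeodesics (F : E n → E n → ℝ) : Prop :=
  ∀ a b, ∃ (x : ℝ → E n) (α β : ℝ), Connects x α β a b ∧
    finslerLength F x α β = finslerDist F a b

end DistSpace

end

open DistSpace

/-! For part (a), the triangle inequality bounds every subdivision sum below by the distance of the
end points. For a continuous curve, uniform continuity makes every fine subdivision almost as good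
as any prescribed one, so the sums converge to their supremum. A smooth curve that overshoots `b`
and returns to it is strictly too long.

For part (b), the bounded first derivatives in (D7) make `ρ(x, x + r y) / r` converge jointly in
base point, direction and `r` (`tendsto_quot`), so `F` is continuous. It is also positive, because
distance balls are convex and the differential of `ρ a` does not vanish (`inducedF_pos`). Comparing
one-sided slopes along a piecewise `C¹` curve gives `ρ ≤ ρ^F` always. Conversely, integrating `F`
over short segments gives `ρ^F ≤ (1 + ε) ρ` near every point (`eventually_finslerDist_le`).

If `ρ = ρ^F`, a geodesic from `a` to `b` has length `ρ a b`, so all its triangle inequalities with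
`a` and `b` are equalities. Strict convexity leaves only one point at given complementary distances
from `a` and `b` (`eq_of_between`), so the osculation curve runs through points of the geodesic, is
isometric to an interval, and has length `ρ a b`.

If quasigeodesic arcs have length `ρ a b`, the same rigidity makes them isometric to intervals.
Propagating the local comparison along such an arc yields `ρ^F(a, b) ≤ (1 + ε) ρ(a, b)` for all `ε >
0` (`finslerDist_le_of_isometric`). Osculation curves exist since distance spheres are compact, and
(D6) turns them into quasigeodesics. -/

namespace DistSpace

variable {n : ℕ} {ρ : E n → E n → ℝ}

/-! ### Subdivisions and distance arc length -/

/-- `t 0 ≤ ⋯ ≤ t N` is a subdivision of `[α, β]`. -/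
structure IsSubdivision (t : ℕ → ℝ) (N : ℕ) (α β : ℝ) : Prop where
  mono : Monotone t
  left : t 0 = α
  right : t N = β

/-- The sum of the distances of consecutive points. -/
noncomputable def polySum (ρ : E n → E n → ℝ) (x : ℝ → E n) (t : ℕ → ℝ) (N : ℕ) : ℝ :=
  ∑ i ∈ Finset.range N, ρ (x (t i)) (x (t (i + 1)))

theorem D1.self_eq_zero (h1 : D1 ρ) (a : E n) : ρ a a = 0 := (h1 a a).2.2 rfl

theorem D1.pos (h1 : D1 ρ) {a b : E n} (h : a ≠ b) : 0 < ρ a b :=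
  lt_of_le_of_ne (h1 a b).1 fun e => h ((h1 a b).2.1 e.symm)

theorem dist_le_polySum_sub (h1 : D1 ρ) (h3 : D3 ρ) (x : ℝ → E n) (t : ℕ → ℝ) {j k : ℕ}
    (h : j ≤ k) : ρ (x (t j)) (x (t k)) ≤ polySum ρ x t k - polySum ρ x t j := by
  induction k, h using Nat.le_induction with
  | base => simp [h1.self_eq_zero]
  | succ k _ ih =>
    have e : polySum ρ x t (k + 1) = polySum ρ x t k + ρ (x (t k)) (x (t (k + 1))) :=
      Finset.sum_range_succ _ _
    have := h3 (x (t j)) (x (t (k + 1))) (x (t k))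
    linarith

theorem polySum_mono (h1 : D1 ρ) (x : ℝ → E n) (t : ℕ → ℝ) : Monotone (polySum ρ x t) := by
  refine monotone_nat_of_le_succ fun k => ?_
  have e : polySum ρ x t (k + 1) = polySum ρ x t k + ρ (x (t k)) (x (t (k + 1))) :=
    Finset.sum_range_succ _ _
  linarith [(h1 (x (t k)) (x (t (k + 1)))).1]

theorem polySum_zero (x : ℝ → E n) (t : ℕ → ℝ) : polySum ρ x t 0 = 0 := Finset.sum_range_zero _

theorem IsSubdivision.dist_le (h1 : D1 ρ) (h3 : D3 ρ) (x : ℝ → E n) {t : ℕ → ℝ} {N : ℕ} {α β : ℝ}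
    (ht : IsSubdivision t N α β) : ρ (x α) (x β) ≤ polySum ρ x t N := by
  have := dist_le_polySum_sub h1 h3 x t (Nat.zero_le N)
  rwa [ht.left, ht.right, polySum_zero, sub_zero] at this

theorem IsSubdivision.mem_Icc {t : ℕ → ℝ} {N : ℕ} {α β : ℝ} (ht : IsSubdivision t N α β) {i : ℕ}
    (hi : i ≤ N) : t i ∈ Icc α β :=
  ⟨ht.left ▸ ht.mono (Nat.zero_le i), ht.right ▸ ht.mono hi⟩

theorem exists_fine_subdivision {α β δ : ℝ} (h : α ≤ β) (hδ : 0 < δ) :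
    ∃ N t, IsSubdivision t N α β ∧ ∀ i < N, t (i + 1) - t i < δ := by
  obtain ⟨N, hN⟩ := exists_nat_ge ((β - α) / (δ / 2))
  -- Steps of `δ / 2` give the strict bound `< δ`; truncation at `β` keeps the sequence monotone on
  -- all of `ℕ`.
  refine ⟨N, fun i => min (α + i * (δ / 2)) β, ⟨?_, by simpa using h, ?_⟩, fun i _ => ?_⟩
  · intro i j hij
    have : (i : ℝ) ≤ j := by exact_mod_cast hij
    dsimp only
    gcongr
  · rw [div_le_iff₀ (by positivity)] at hN
    exact min_eq_right (by linarith)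
  · push_cast
    rcases le_total (α + i * (δ / 2)) β with hc | hc
    · rw [min_eq_left hc]
      linarith [min_le_left (α + (i + 1) * (δ / 2)) β]
    · rw [min_eq_right hc]
      linarith [min_le_right (α + ((i : ℝ) + 1) * (δ / 2)) β]

/-- Fine subdivisions can be joined. -/
theorem IsSubdivision.append {t s : ℕ → ℝ} {N M : ℕ} {α β γ : ℝ}
    (ht : IsSubdivision t N α β) (hs : IsSubdivision s M β γ) :
    ∃ u, IsSubdivision u (N + M) α γ ∧ (∀ i ≤ N, u i = t i) ∧ ∀ i, u (N + i) = s i := by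
  refine ⟨fun i => if i ≤ N then t i else s (i - N), ⟨?_, ?_, ?_⟩, ?_, ?_⟩
  · refine monotone_nat_of_le_succ fun i => ?_
    by_cases h : i + 1 ≤ N
    · simpa [h, (Nat.le_succ i).trans h] using ht.mono (Nat.le_succ i)
    · by_cases h' : i ≤ N
      · have := (ht.mem_Icc h').2
        have := hs.left ▸ hs.mono (Nat.zero_le (i + 1 - N))
        simp only [h, h', if_true, if_false]
        linarith
      · simp only [h, h', if_false]
        exact hs.mono (by omega)
  · simpa using ht.left
  · rcases Nat.eq_zero_or_pos M with rfl | hM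
    · simp [ht.right, ← hs.right, hs.left]
    · have : ¬ N + M ≤ N := by omega
      simp [hM.ne', hs.right]
  · intro i hi
    simp [hi]
  · intro i
    rcases Nat.eq_zero_or_pos i with rfl | hi
    · simp [ht.right, hs.left]
    · simp [hi.ne']

theorem fine_append {t s u : ℕ → ℝ} {N M : ℕ} {δ : ℝ} (h : ∀ i ≤ N, u i = t i)
    (h' : ∀ i, u (N + i) = s i) (ht : ∀ i < N, t (i + 1) - t i < δ)
    (hs : ∀ i < M, s (i + 1) - s i < δ) : ∀ i < N + M, u (i + 1) - u i < δ := by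
  intro i hi
  rcases lt_or_ge i N with hlt | hge
  · rw [h i hlt.le, h (i + 1) hlt]
    exact ht i hlt
  · obtain ⟨j, rfl⟩ := Nat.exists_eq_add_of_le hge
    rw [h' j, add_assoc, h' (j + 1)]
    exact hs j (by omega)

theorem polySum_append {t s u : ℕ → ℝ} {N : ℕ} (x : ℝ → E n) (M : ℕ) (h : ∀ i ≤ N, u i = t i)
    (h' : ∀ i, u (N + i) = s i) :
    polySum ρ x u (N + M) = polySum ρ x t N + polySum ρ x s M := by
  unfold polySum
  rw [Finset.sum_range_add]
  congr 1
  · refine Finset.sum_congr rfl fun i hi => ?_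
    have := Finset.mem_range.1 hi
    rw [h i this.le, h (i + 1) this]
  · refine Finset.sum_congr rfl fun i _ => ?_
    rw [h' i, add_assoc, h' (i + 1)]

theorem dist_le_distLength (h1 : D1 ρ) (h3 : D3 ρ) {x : ℝ → E n} {α β : ℝ} {L : ℝ≥0∞}
    (hαβ : α ≤ β) (h : HasDistLength ρ x α β L) : ENNReal.ofReal (ρ (x α) (x β)) ≤ L := by
  by_contra! hlt
  obtain ⟨δ, hδ, H⟩ := h _ (Iio_mem_nhds hlt)
  obtain ⟨N, t, ht, hm⟩ := exists_fine_subdivision hαβ hδ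
  exact absurd (H N t ht.mono ht.left ht.right hm)
    (not_lt.2 (ENNReal.ofReal_le_ofReal (ht.dist_le h1 h3 x)))

/-- The supremum of the sums over all subdivisions. -/
noncomputable def supLength (ρ : E n → E n → ℝ) (x : ℝ → E n) (α β : ℝ) : ℝ≥0∞ :=
  ⨆ (N : ℕ) (t : ℕ → ℝ) (_ : IsSubdivision t N α β), ENNReal.ofReal (polySum ρ x t N)

theorem IsSubdivision.le_supLength (x : ℝ → E n) {t : ℕ → ℝ} {N : ℕ} {α β : ℝ}
    (ht : IsSubdivision t N α β) : ENNReal.ofReal (polySum ρ x t N) ≤ supLength ρ x α β :=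
  le_iSup_of_le N (le_iSup_of_le t (le_iSup_of_le ht le_rfl))

/-- The function `(s, t) ↦ ρ (x s) (x t)` is uniformly continuous on the compact square and vanishes
on the diagonal. -/
theorem exists_modulus (h1 : D1 ρ) (hc : Continuous fun z : E n × E n => ρ z.1 z.2) {x : ℝ → E n}
    {α β : ℝ} (hx : ContinuousOn x (Icc α β)) {η : ℝ} (hη : 0 < η) :
    ∃ δ > 0, ∀ s ∈ Icc α β, ∀ t ∈ Icc α β, |s - t| < δ → ρ (x s) (x t) < η := by
  have hcont : ContinuousOn (fun z : ℝ × ℝ => ρ (x z.1) (x z.2)) (Icc α β ×ˢ Icc α β) := by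
    have : ContinuousOn (fun z : ℝ × ℝ => (x z.1, x z.2)) (Icc α β ×ˢ Icc α β) :=
      (hx.comp continuousOn_fst fun z hz => hz.1).prodMk (hx.comp continuousOn_snd fun z hz => hz.2)
    exact hc.comp_continuousOn this
  have hu := (isCompact_Icc.prod isCompact_Icc).uniformContinuousOn_of_continuous hcont
  obtain ⟨δ, hδ, H⟩ := Metric.uniformContinuousOn_iff.1 hu η hη
  refine ⟨δ, hδ, fun s hs t ht hst => ?_⟩
  have := H (s, t) ⟨hs, ht⟩ (s, s) ⟨hs, hs⟩ (by
    simpa [Prod.dist_eq, Real.dist_eq, abs_sub_comm t s, hδ] using hst)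
  simp only [h1.self_eq_zero, Real.dist_eq, sub_zero] at this
  exact (le_abs_self _).trans_lt this

/-- The sum over a fine subdivision almost reaches the sum over a given one. -/
theorem IsSubdivision.polySum_le_of_fine (h1 : D1 ρ) (h2 : D2 ρ) (h3 : D3 ρ) {x : ℝ → E n}
    {α β δ η : ℝ} {p t : ℕ → ℝ} {M N : ℕ} (hp : IsSubdivision p M α β)
    (ht : IsSubdivision t N α β) (hδ : 0 < δ) (hm : ∀ i < N, t (i + 1) - t i < δ)
    (H : ∀ s ∈ Icc α β, ∀ t ∈ Icc α β, |s - t| < δ → ρ (x s) (x t) < η) :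
    polySum ρ x p M ≤ polySum ρ x t N + M * (2 * η) := by
  classical
  -- `k c` is the last index up to `N` with `t (k c) ≤ c`. Passing from `p j` to `p (j + 1)` through
  -- the points `t (k (p j))` and `t (k (p (j + 1)))` costs at most two detours below `η`, and the
  -- middle pieces telescope.
  set k : ℝ → ℕ := fun c => Nat.findGreatest (fun i => t i ≤ c) N with hk
  have hkN (c) : k c ≤ N := Nat.findGreatest_le N
  have hkmono : Monotone k := fun c d hcd =>
    Nat.findGreatest_mono_left (fun i hi => le_trans hi hcd) N
  have hkc : ∀ c ∈ Icc α β, |c - t (k c)| < δ := by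
    intro c hc
    have hle : t (k c) ≤ c :=
      Nat.findGreatest_spec (P := fun i => t i ≤ c) (Nat.zero_le N) (ht.left.le.trans hc.1)
    rw [abs_of_nonneg (sub_nonneg.2 hle)]
    rcases (hkN c).lt_or_eq with hlt | heq
    · have : ¬ t (k c + 1) ≤ c :=
        Nat.findGreatest_is_greatest (P := fun i => t i ≤ c) (Nat.lt_succ_self _) hlt
      linarith [hm _ hlt]
    · have : t (k c) = β := by rw [heq, ht.right]
      linarith [hc.2]
  have key : ∀ j ∈ Finset.range M, ρ (x (p j)) (x (p (j + 1))) ≤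
      (polySum ρ x t (k (p (j + 1))) - polySum ρ x t (k (p j))) + 2 * η := by
    intro j hj
    have hj' := Finset.mem_range.1 hj
    have m1 := hp.mem_Icc hj'.le
    have m2 := hp.mem_Icc (Nat.succ_le_of_lt hj')
    have e1 := H _ m1 _ (ht.mem_Icc (hkN (p j))) (hkc _ m1)
    have e2 := H _ m2 _ (ht.mem_Icc (hkN (p (j + 1)))) (hkc _ m2)
    have e3 := dist_le_polySum_sub h1 h3 x t (hkmono (hp.mono (Nat.le_succ j)))
    have e4 := h3 (x (p j)) (x (p (j + 1))) (x (t (k (p j))))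
    have e5 := h3 (x (t (k (p j)))) (x (p (j + 1))) (x (t (k (p (j + 1)))))
    rw [h2 (x (t (k (p (j + 1))))) (x (p (j + 1)))] at e5
    linarith
  calc polySum ρ x p M ≤ ∑ j ∈ Finset.range M,
        ((polySum ρ x t (k (p (j + 1))) - polySum ρ x t (k (p j))) + 2 * η) :=
        Finset.sum_le_sum key
    _ = polySum ρ x t (k (p M)) - polySum ρ x t (k (p 0)) + M * (2 * η) := by
        rw [Finset.sum_add_distrib, Finset.sum_range_sub (fun j => polySum ρ x t (k (p j)))]
        simp
    _ ≤ polySum ρ x t N + M * (2 * η) := by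
        have := polySum_mono h1 x t (hkN (p M))
        have := polySum_mono h1 x t (Nat.zero_le (k (p 0)))
        rw [polySum_zero] at this
        linarith

/-- The supremum is the limit: for each `c` below it some subdivision has a sum above `c`, and all
sufficiently fine subdivisions then stay above `c` too. This also covers the value `∞`. -/
theorem hasDistLength_supLength (h1 : D1 ρ) (h2 : D2 ρ) (h3 : D3 ρ)
    (hc : Continuous fun z : E n × E n => ρ z.1 z.2) {x : ℝ → E n} {α β : ℝ}
    (hx : ContinuousOn x (Icc α β)) : HasDistLength ρ x α β (supLength ρ x α β) := by
  intro U hU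
  rcases eq_or_ne (supLength ρ x α β) 0 with h0 | h0
  -- A supremum of `0` leaves no room for a value `c` below it, but then all sums vanish.
  · refine ⟨1, one_pos, fun N t hm h0' hN _ => ?_⟩
    have := IsSubdivision.le_supLength (ρ := ρ) x (t := t) ⟨hm, h0', hN⟩
    rw [h0, nonpos_iff_eq_zero] at this
    change ENNReal.ofReal (polySum ρ x t N) ∈ U
    rw [this, ← h0]
    exact mem_of_mem_nhds hU
  · obtain ⟨c, hcL, hcU⟩ := exists_Ioc_subset_of_mem_nhds hU ⟨0, pos_iff_ne_zero.2 h0⟩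
    obtain ⟨M, p, hp, hcp⟩ : ∃ M p, IsSubdivision p M α β ∧ c < ENNReal.ofReal (polySum ρ x p M) := by
      unfold supLength at hcL
      simp only [lt_iSup_iff] at hcL
      obtain ⟨M, p, hp, h⟩ := hcL
      exact ⟨M, p, hp, h⟩
    have hcS : c.toReal < polySum ρ x p M :=
      (ENNReal.lt_ofReal_iff_toReal_lt hcp.ne_top).1 hcp
    obtain ⟨η, hη, hMη⟩ : ∃ η > 0, M * (2 * η) < polySum ρ x p M - c.toReal := by
      -- The denominator contains `M + 1` rather than `M` so that `M = 0` is allowed.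
      refine ⟨(polySum ρ x p M - c.toReal) / (2 * (M + 1)),
        div_pos (by linarith) (by positivity), ?_⟩
      have hpos : 0 < polySum ρ x p M - c.toReal := by linarith
      have : (M : ℝ) * (2 * ((polySum ρ x p M - c.toReal) / (2 * (M + 1)))) =
        (M / (M + 1)) * (polySum ρ x p M - c.toReal) := by
        field_simp
      rw [this]
      refine mul_lt_of_lt_one_left hpos ((div_lt_one (by positivity)).2 (by linarith))
    obtain ⟨δ, hδ, H⟩ := exists_modulus h1 hc hx hη
    refine ⟨δ, hδ, fun N t hm h0' hN hfine => hcU ⟨?_, ?_⟩⟩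
    · have ht : IsSubdivision t N α β := ⟨hm, h0', hN⟩
      have := hp.polySum_le_of_fine h1 h2 h3 ht hδ hfine H
      rw [ENNReal.lt_ofReal_iff_toReal_lt hcp.ne_top]
      change c.toReal < polySum ρ x t N
      linarith
    · exact IsSubdivision.le_supLength x ⟨hm, h0', hN⟩

theorem exists_curve_longer (h1 : D1 ρ) (h2 : D2 ρ) (h3 : D3 ρ)
    (hc : Continuous fun z : E n × E n => ρ z.1 z.2) (hn : 0 < n) (a b : E n) :
    ∃ (x : ℝ → E n) (L : ℝ≥0∞), ContDiff ℝ ∞ x ∧ x 0 = a ∧ x 1 = b ∧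
      HasDistLength ρ x 0 1 L ∧ ENNReal.ofReal (ρ a b) < L := by
  have : Nonempty (Fin n) := ⟨⟨0, hn⟩⟩
  obtain ⟨c, hcb⟩ := exists_ne b
  -- the curve passes through `a`, `b`, `c`, `b` at the times `0`, `1/3`, `2/3`, `1`
  set x : ℝ → E n := fun t => a + (1 - (1 - 3 * t) * (1 - 3 / 2 * t) * (1 - t)) • (b - a)
      + (9 / 2 * t * (3 * t - 1) * (1 - t)) • (c - b) with hx
  have x0 : x 0 = a := by simp [hx]
  have x1 : x 1 = b := by simp [hx]
  have x13 : x (1 / 3) = b := by simp [hx]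
  have x23 : x (2 / 3) = c := by norm_num [hx]
  have hsm : ContDiff ℝ ∞ x := by fun_prop
  refine ⟨x, supLength ρ x 0 1, hsm, x0, x1,
    hasDistLength_supLength h1 h2 h3 hc hsm.continuous.continuousOn, ?_⟩
  have ht : IsSubdivision (fun i : ℕ => (i : ℝ) / 3) 3 0 1 :=
    ⟨fun i j hij => by gcongr, by simp, by simp⟩
  refine lt_of_lt_of_le ?_ (ht.le_supLength x)
  have e : polySum ρ x (fun i : ℕ => (i : ℝ) / 3) 3 = ρ a b + ρ b c + ρ c b := by
    simp only [polySum, Finset.sum_range_succ, Finset.sum_range_zero, zero_add]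
    norm_num [x0, x1, x13, x23]
  rw [e]
  have p1 := h1.pos hcb
  have p2 := h1.pos hcb.symm
  have p3 := (h1 a b).1
  exact (ENNReal.ofReal_lt_ofReal_iff (by linarith)).2 (by linarith)

/-! ### The limit function of the induced Finsler space -/

/-- Central projection from a hyperplane orthogonal to `v` onto the unit sphere, and its inverse. -/
theorem exists_sphere_chart {m : ℕ} {v : E (m + 1)} (hv : v ≠ 0) :
    ∃ (ψ : E m → E (m + 1)) (g : E (m + 1) → E m), ContDiff ℝ ∞ ψ ∧ (∀ u, ‖ψ u‖ = 1) ∧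
      Function.Injective ψ ∧ (∀ u, Function.Injective (fderiv ℝ ψ u)) ∧ ContinuousAt g v ∧
      ∀ w, 0 < inner ℝ v w → ψ (g w) = ‖w‖⁻¹ • w := by
  have : Fact (Module.finrank ℝ (E (m + 1)) = m + 1) := ⟨by simp⟩
  let e := (OrthonormalBasis.fromOrthogonalSpanSingleton (𝕜 := ℝ) m hv).repr
  let A : E m →L[ℝ] E (m + 1) :=
    (Submodule.span ℝ {v})ᗮ.subtypeL ∘L (e.symm.toContinuousLinearEquiv : E m →L[ℝ] _)
  let P : E (m + 1) →L[ℝ] E m :=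
    (e.toContinuousLinearEquiv : _ →L[ℝ] E m) ∘L
      (Submodule.span ℝ {v})ᗮ.orthogonalProjectionOnto
  have hvv : 0 < inner ℝ v v := real_inner_self_pos.2 hv
  have hPA (u) : P (A u) = u := by simp [P, A]
  have hPv : P v = 0 := by
    simp only [P, ContinuousLinearMap.comp_apply]
    rw [Submodule.orthogonalProjectionOnto_orthogonal_apply_eq_zero (Submodule.mem_span_singleton_self v)]
    simp
  have hvA (u) : inner ℝ v (A u) = 0 :=
    Submodule.mem_orthogonal_singleton_iff_inner_right.1 (e.symm u).2
  have hdec (w) : (inner ℝ v w / inner ℝ v v) • v + A (P w) = w := by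
    have h1 : A (P w) = (Submodule.span ℝ {v})ᗮ.orthogonalProjectionOnto w := by simp [P, A]
    have h2 := (Submodule.span ℝ {v}).starProjection_add_starProjection_orthogonal w
    rw [Submodule.starProjection_singleton] at h2
    rw [h1, real_inner_self_eq_norm_sq]
    exact h2
  have hne (u) : v + A u ≠ 0 := by
    intro h
    have := congrArg (fun w => inner ℝ v w) h
    simp only [inner_add_right, hvA, add_zero, inner_zero_right] at this
    exact hvv.ne' this
  set ψ : E m → E (m + 1) := fun u => ‖v + A u‖⁻¹ • (v + A u) with hψ
  set g : E (m + 1) → E m := fun w => (inner ℝ v v / inner ℝ v w) • P w with hg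
  have hψs : ContDiff ℝ ∞ ψ := by
    have h1 : ContDiff ℝ ∞ fun u => v + A u := by fun_prop
    exact ((h1.norm ℝ hne).inv fun u => norm_ne_zero_iff.2 (hne u)).smul h1
  have hinner (u) : inner ℝ v (ψ u) = ‖v + A u‖⁻¹ * inner ℝ v v := by
    simp only [hψ, inner_smul_right, inner_add_right, hvA, add_zero]
  have hgψ (u) : g (ψ u) = u := by
    have h0 : ‖v + A u‖ ≠ 0 := norm_ne_zero_iff.2 (hne u)
    simp only [hg]
    rw [hinner]
    simp only [hψ, map_smul, map_add, hPv, hPA, zero_add, smul_smul]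
    rw [show inner ℝ v v / (‖v + A u‖⁻¹ * inner ℝ v v) * ‖v + A u‖⁻¹ = 1 by field_simp, one_smul]
  have hgd {w} (hw : inner ℝ v w ≠ 0) : DifferentiableAt ℝ g w := by
    have h1 : DifferentiableAt ℝ (fun w => inner ℝ v w) w :=
      (innerSL ℝ v).differentiableAt
    have h2 : DifferentiableAt ℝ (fun w => inner ℝ v v / inner ℝ v w) w := by
      simpa only [div_eq_mul_inv] using (h1.fun_inv hw).const_mul (inner ℝ v v)
    exact h2.smul P.differentiableAt
  refine ⟨ψ, g, hψs, fun u => ?_, Function.LeftInverse.injective hgψ, fun u => ?_,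
    (hgd hvv.ne').continuousAt, fun w hw => ?_⟩
  · rw [hψ, norm_smul, norm_inv, norm_norm, inv_mul_cancel₀ (norm_ne_zero_iff.2 (hne u))]
  -- The derivative is injective by the chain rule, since `g` is a differentiable left inverse of
  -- `ψ`.
  · have h0 : inner ℝ v (ψ u) ≠ 0 := by
      rw [hinner]
      exact mul_ne_zero (inv_ne_zero (norm_ne_zero_iff.2 (hne u))) hvv.ne'
    have hc := (hgd h0).hasFDerivAt.comp u (hψs.differentiable (by simp) u).hasFDerivAt
    have hid : g ∘ ψ = id := funext hgψ
    rw [hid] at hc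
    have := hc.unique (hasFDerivAt_id u)
    refine Function.LeftInverse.injective (g := fderiv ℝ g (ψ u)) fun y => ?_
    simpa using congrArg (fun T => T y) this
  · have h1 : v + A (g w) = (inner ℝ v v / inner ℝ v w) • w := by
      have h2 := congrArg (fun z => (inner ℝ v v / inner ℝ v w) • z) (hdec w)
      simp only [smul_add, smul_smul] at h2
      rw [show inner ℝ v v / inner ℝ v w * (inner ℝ v w / inner ℝ v v) = 1 by field_simp,
        one_smul] at h2
      simpa only [hg, map_smul] using h2
    have hpos : 0 < inner ℝ v v / inner ℝ v w := div_pos hvv hw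
    simp only [hψ]
    rw [h1, norm_smul, Real.norm_of_nonneg hpos.le, smul_smul]
    congr 1
    field_simp

/-- The difference quotient `((x, y), r) ↦ ρ(x, x + r y) / r`. -/
noncomputable def quot (ρ : E n → E n → ℝ) (z : (E n × E n) × ℝ) : ℝ :=
  ρ z.1.1 (z.1.1 + z.2 • z.1.2) / z.2

/-- In a sphere chart around the direction of `y₀`, (D7) with `k = 1` bounds the derivative of `ρ /
r` on a convex half-ball. Hence `ρ / r` is Lipschitz there and extends continuously to `r = 0`. -/
theorem exists_tendsto_quot (h4 : D4 ρ) (h7 : D7 ρ) (p : E n) {y₀ : E n} (hy : y₀ ≠ 0) :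
    ∃ l, Tendsto (quot ρ) (𝓝 (p, y₀) ×ˢ 𝓝[>] 0) (𝓝 l) := by
  obtain _ | m := n
  · exact absurd (Subsingleton.elim y₀ 0) hy
  obtain ⟨ψ, g, hψ, hnorm, hinj, hinj', hg, hψg⟩ := exists_sphere_chart hy
  set G : E (m + 1) × E m × ℝ → ℝ := fun z => ρ z.1 (z.1 + z.2.2 • ψ z.2.1) / z.2.2 with hG
  obtain ⟨C, hC⟩ := h7 univ ψ isOpen_univ hψ.contDiffOn (fun u _ => hnorm u) hinj.injOn
    (fun u _ => hinj' u) 1 p (g y₀) (mem_univ _)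
  obtain ⟨ε, hε, hball⟩ := Metric.mem_nhdsWithin_iff.1 hC
  set S : Set (E (m + 1) × E m × ℝ) :=
    Metric.ball (p, g y₀, (0 : ℝ)) ε ∩ {z | 0 < z.2.2} with hS
  have hd : ∀ z ∈ S, DifferentiableAt ℝ G z := by
    rintro ⟨x, u, r⟩ ⟨-, hr⟩
    replace hr : 0 < r := hr
    have hne : x ≠ x + r • ψ u := by
      intro h
      have h0 : r • ψ u = 0 := by simpa using h
      have := congrArg norm h0
      rw [norm_smul, hnorm, norm_zero, mul_one, norm_eq_zero] at this
      exact hr.ne' this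
    have hρ : DifferentiableAt ℝ (fun z : E (m + 1) × E (m + 1) => ρ z.1 z.2) (x, x + r • ψ u) :=
      (h4.2.contDiffAt ((isOpen_ne_fun continuous_fst continuous_snd).mem_nhds hne)).differentiableAt
        (by simp)
    have hin : DifferentiableAt ℝ
        (fun z : E (m + 1) × E m × ℝ => (z.1, z.1 + z.2.2 • ψ z.2.1)) (x, u, r) := by
      have := hψ.differentiable (by simp)
      fun_prop
    have hcomp : DifferentiableAt ℝ
        (fun z : E (m + 1) × E m × ℝ => ρ z.1 (z.1 + z.2.2 • ψ z.2.1)) (x, u, r) :=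
      DifferentiableAt.comp (x, u, r) (f := fun z : E (m + 1) × E m × ℝ =>
        (z.1, z.1 + z.2.2 • ψ z.2.1)) hρ hin
    have hden : DifferentiableAt ℝ (fun z : E (m + 1) × E m × ℝ => z.2.2) (x, u, r) := by fun_prop
    simpa only [hG, div_eq_mul_inv] using hcomp.fun_mul (hden.fun_inv hr.ne')
  have hb : ∀ z ∈ S, ‖fderiv ℝ G z‖₊ ≤ C.toNNReal := by
    intro z hz
    have : ‖iteratedFDeriv ℝ 1 G z‖ ≤ C := hball hz
    rw [norm_iteratedFDeriv_one] at this
    rw [← NNReal.coe_le_coe]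
    exact this.trans (Real.le_coe_toNNReal C)
  have hconv : Convex ℝ S := by
    refine (convex_ball _ _).inter ?_
    have : {z : E (m + 1) × E m × ℝ | 0 < z.2.2} =
        (LinearMap.snd ℝ (E m) ℝ ∘ₗ LinearMap.snd ℝ (E (m + 1)) (E m × ℝ)) ⁻¹' Ioi 0 := rfl
    rw [this]
    exact (convex_Ioi 0).linear_preimage _
  obtain ⟨K, hK, hKG⟩ :=
    (hconv.lipschitzOnWith_of_nnnorm_fderiv_le hd hb).extend_real
  -- Since `x + r y = x + (r ‖y‖) (y / ‖y‖)`, the chart is used at the unit direction of `y` with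
  -- radius `r ‖y‖`; the factor `‖y‖` in the limit compensates for the changed denominator.
  set T : (E (m + 1) × E (m + 1)) × ℝ → E (m + 1) × E m × ℝ :=
    fun z => (z.1.1, g z.1.2, z.2 * ‖z.1.2‖) with hT
  have hr0 : Tendsto (fun z : (E (m + 1) × E (m + 1)) × ℝ => z.2)
      (𝓝 (p, y₀) ×ˢ 𝓝[>] 0) (𝓝 0) := tendsto_snd.mono_right nhdsWithin_le_nhds
  have hfst : Tendsto (fun z : (E (m + 1) × E (m + 1)) × ℝ => z.1.1)
      (𝓝 (p, y₀) ×ˢ 𝓝[>] 0) (𝓝 p) := (continuous_fst.tendsto (p, y₀)).comp tendsto_fst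
  have hsnd : Tendsto (fun z : (E (m + 1) × E (m + 1)) × ℝ => z.1.2)
      (𝓝 (p, y₀) ×ˢ 𝓝[>] 0) (𝓝 y₀) := (continuous_snd.tendsto (p, y₀)).comp tendsto_fst
  have hTt : Tendsto T (𝓝 (p, y₀) ×ˢ 𝓝[>] 0) (𝓝 (p, g y₀, 0)) := by
    refine hfst.prodMk_nhds ((hg.tendsto.comp hsnd).prodMk_nhds ?_)
    simpa using hr0.mul hsnd.norm
  refine ⟨K (p, g y₀, 0) * ‖y₀‖, ?_⟩
  refine (((hK.continuous.tendsto _).comp hTt).mul hsnd.norm).congr' ?_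
  have hpos : ∀ᶠ z : (E (m + 1) × E (m + 1)) × ℝ in 𝓝 (p, y₀) ×ˢ 𝓝[>] 0, 0 < z.2 :=
    tendsto_snd.eventually self_mem_nhdsWithin
  have hin : ∀ᶠ z : (E (m + 1) × E (m + 1)) × ℝ in 𝓝 (p, y₀) ×ˢ 𝓝[>] 0, 0 < inner ℝ y₀ z.1.2 :=
    (tendsto_const_nhds.inner hsnd).eventually (lt_mem_nhds (real_inner_self_pos.2 hy))
  filter_upwards [hpos, hin, hTt.eventually (Metric.ball_mem_nhds _ hε)] with z hz hz' hzb
  have hy0 : z.1.2 ≠ 0 := by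
    intro h
    simp [h] at hz'
  have hn0 : 0 < ‖z.1.2‖ := norm_pos_iff.2 hy0
  have hmem : T z ∈ S := ⟨hzb, mul_pos hz hn0⟩
  simp only [Function.comp_apply]
  rw [← hKG hmem]
  simp only [hG, hT, quot]
  rw [hψg _ hz', smul_smul, mul_assoc, mul_inv_cancel₀ hn0.ne', mul_one]
  field_simp

/-- Near `p`, the distance function is dominated by a multiple of the norm. -/
theorem exists_bound_quot (h4 : D4 ρ) (h7 : D7 ρ) (p : E n) :
    ∃ C, ∀ᶠ z : E n × ℝ in 𝓝 p ×ˢ 𝓝[>] 0, ∀ w ∈ Metric.sphere (0 : E n) 1,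
      ρ z.1 (z.1 + z.2 • w) ≤ C * z.2 := by
  refine (isCompact_sphere (0 : E n) 1).induction_on
    (p := fun S => ∃ C, ∀ᶠ z : E n × ℝ in 𝓝 p ×ˢ 𝓝[>] 0, ∀ w ∈ S,
      ρ z.1 (z.1 + z.2 • w) ≤ C * z.2) ?_ ?_ ?_ ?_
  · exact ⟨0, by simp⟩
  · rintro s t hst ⟨C, hC⟩
    exact ⟨C, hC.mono fun z hz w hw => hz w (hst hw)⟩
  · rintro s t ⟨C, hC⟩ ⟨D, hD⟩
    refine ⟨max C D, ?_⟩
    filter_upwards [hC, hD, tendsto_snd.eventually (self_mem_nhdsWithin)] with z h1 h2 h3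
    replace h3 : 0 < z.2 := h3
    rintro w (hw | hw)
    · exact (h1 w hw).trans (by gcongr; exact le_max_left _ _)
    · exact (h2 w hw).trans (by gcongr; exact le_max_right _ _)
  · intro w hw
    have hw0 : w ≠ 0 := by
      rintro rfl
      simp at hw
    obtain ⟨l, hl⟩ := exists_tendsto_quot h4 h7 p hw0
    have h := hl.eventually (gt_mem_nhds (lt_add_one l))
    rw [nhds_prod_eq, eventually_prod_iff] at h
    obtain ⟨P, hP, Q, hQ, H⟩ := h
    obtain ⟨P₁, hP₁, P₂, hP₂, HP⟩ := eventually_prod_iff.1 hP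
    refine ⟨{w | P₂ w}, mem_nhdsWithin_of_mem_nhds hP₂, l + 1, ?_⟩
    filter_upwards [hP₁.prod_mk (hQ.and self_mem_nhdsWithin)] with z hz w' hw'
    have := H (HP hz.1 hw') hz.2.1
    have hr : 0 < z.2 := hz.2.2
    simp only [quot] at this
    exact ((div_lt_iff₀ hr).1 this).le

/-- The direction `0` lies in no sphere chart. The linear bound of `exists_bound_quot` squeezes the
quotient between `0` and `C ‖y‖`. -/
theorem tendsto_quot_zero (h1 : D1 ρ) (h4 : D4 ρ) (h7 : D7 ρ) (p : E n) :
    Tendsto (quot ρ) (𝓝 (p, 0) ×ˢ 𝓝[>] 0) (𝓝 0) := by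
  obtain ⟨C, hC⟩ := exists_bound_quot h4 h7 p
  have hr0 : Tendsto (fun z : (E n × E n) × ℝ => z.2)
      (𝓝 (p, 0) ×ˢ 𝓝[>] 0) (𝓝[>] 0) := tendsto_snd
  have hfst : Tendsto (fun z : (E n × E n) × ℝ => z.1.1)
      (𝓝 (p, 0) ×ˢ 𝓝[>] 0) (𝓝 p) := (continuous_fst.tendsto (p, (0 : E n))).comp tendsto_fst
  have hsnd : Tendsto (fun z : (E n × E n) × ℝ => z.1.2)
      (𝓝 (p, 0) ×ˢ 𝓝[>] 0) (𝓝 0) := (continuous_snd.tendsto (p, (0 : E n))).comp tendsto_fst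
  obtain ⟨P, hP, Q, hQ, H⟩ := eventually_prod_iff.1 hC
  obtain ⟨ε, hε, hQε⟩ := Metric.mem_nhdsWithin_iff.1 hQ
  have hprod : Tendsto (fun z : (E n × E n) × ℝ => z.2 * ‖z.1.2‖)
      (𝓝 (p, 0) ×ˢ 𝓝[>] 0) (𝓝 0) := by
    simpa using (hr0.mono_right nhdsWithin_le_nhds).mul hsnd.norm
  have hbound : Tendsto (fun z : (E n × E n) × ℝ => C * ‖z.1.2‖)
      (𝓝 (p, 0) ×ˢ 𝓝[>] 0) (𝓝 0) := by
    simpa using hsnd.norm.const_mul C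
  refine tendsto_of_tendsto_of_tendsto_of_le_of_le' tendsto_const_nhds hbound ?_ ?_
  · filter_upwards [hr0.eventually self_mem_nhdsWithin] with z hz
    exact div_nonneg (h1 _ _).1 (le_of_lt hz)
  · filter_upwards [hr0.eventually self_mem_nhdsWithin, hfst.eventually hP,
      hprod.eventually (Metric.ball_mem_nhds _ hε)] with z hz hz1 hz2
    replace hz : 0 < z.2 := hz
    rcases eq_or_ne z.1.2 0 with h0 | h0
    · simp [quot, h0, h1.self_eq_zero]
    have hn0 : 0 < ‖z.1.2‖ := norm_pos_iff.2 h0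
    have := H hz1 (hQε ⟨hz2, mul_pos hz hn0⟩) (‖z.1.2‖⁻¹ • z.1.2)
      (by simp [norm_smul, hn0.ne'])
    simp only [smul_smul] at this
    rw [mul_assoc, mul_inv_cancel₀ hn0.ne', mul_one] at this
    rw [quot, div_le_iff₀ hz]
    linarith

/-- The joint convergence, with base point and direction varying, is what yields both the continuity
of `F` and the comparison of `F` with `ρ` along curves. -/
theorem tendsto_quot (h1 : D1 ρ) (h4 : D4 ρ) (h7 : D7 ρ) (p y : E n) :
    Tendsto (quot ρ) (𝓝 (p, y) ×ˢ 𝓝[>] 0) (𝓝 (inducedF ρ p y)) := by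
  obtain ⟨l, hl⟩ : ∃ l, Tendsto (quot ρ) (𝓝 (p, y) ×ˢ 𝓝[>] 0) (𝓝 l) := by
    rcases eq_or_ne y 0 with rfl | hy
    · exact ⟨0, tendsto_quot_zero h1 h4 h7 p⟩
    · exact exists_tendsto_quot h4 h7 p hy
  have hc : Tendsto (fun r : ℝ => ((p, y), r)) (𝓝[>] 0) (𝓝 (p, y) ×ˢ 𝓝[>] 0) :=
    tendsto_const_nhds.prodMk tendsto_id
  have : inducedF ρ p y = l := (hl.comp hc).limUnder_eq
  rwa [this]

theorem tendsto_quot_right (h1 : D1 ρ) (h4 : D4 ρ) (h7 : D7 ρ) (p y : E n) :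
    Tendsto (fun r => ρ p (p + r • y) / r) (𝓝[>] 0) (𝓝 (inducedF ρ p y)) :=
  (tendsto_quot h1 h4 h7 p y).comp
    (tendsto_const_nhds.prodMk tendsto_id :
      Tendsto (fun r : ℝ => ((p, y), r)) (𝓝[>] 0) (𝓝 (p, y) ×ˢ 𝓝[>] 0))

theorem inducedF_zero (h1 : D1 ρ) (p : E n) : inducedF ρ p 0 = 0 := by
  have : (fun r : ℝ => ρ p (p + r • (0 : E n)) / r) = fun _ => 0 := by
    funext r
    simp [h1.self_eq_zero]
  unfold inducedF
  rw [this]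
  exact tendsto_const_nhds.limUnder_eq

theorem inducedF_smul (h1 : D1 ρ) (h4 : D4 ρ) (h7 : D7 ρ) (p y : E n) {c : ℝ} (hc : 0 < c) :
    inducedF ρ p (c • y) = c * inducedF ρ p y := by
  have h := tendsto_quot_right h1 h4 h7 p (c • y)
  have hm : Tendsto (fun r : ℝ => r * c) (𝓝[>] 0) (𝓝[>] 0) := by
    refine tendsto_nhdsWithin_iff.2 ⟨?_, ?_⟩
    · exact ((continuous_id.mul continuous_const).tendsto' 0 0 (by simp)).mono_left
        nhdsWithin_le_nhds
    · filter_upwards [self_mem_nhdsWithin] with r hr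
      exact mul_pos hr hc
  have h' := ((tendsto_quot_right h1 h4 h7 p y).comp hm).const_mul c
  refine tendsto_nhds_unique h (h'.congr fun r => ?_)
  simp only [Function.comp_apply, smul_smul]
  field_simp

/-- For `z` near `(p, y)` the quotients with small `r` already lie in a closed ball around `F(p,
y)`; letting `r → 0` keeps the limit `F z` in it. -/
theorem continuous_inducedF (h1 : D1 ρ) (h4 : D4 ρ) (h7 : D7 ρ) :
    Continuous fun z : E n × E n => inducedF ρ z.1 z.2 := by
  rw [continuous_iff_continuousAt]
  rintro ⟨p, y⟩
  refine Metric.tendsto_nhds.2 fun ε hε => ?_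
  have h := (tendsto_quot h1 h4 h7 p y).eventually (Metric.ball_mem_nhds _ (half_pos hε))
  filter_upwards [h.curry] with z hz
  have : inducedF ρ z.1 z.2 ∈ Metric.closedBall (inducedF ρ p y) (ε / 2) :=
    Metric.isClosed_closedBall.mem_of_tendsto (tendsto_quot_right h1 h4 h7 z.1 z.2)
      (hz.mono fun r hr => Metric.ball_subset_closedBall hr)
  exact lt_of_le_of_lt this (half_lt_self hε)

/-! ### Finsler length of piecewise smooth curves -/

/-- A transitive relation between the points of an interval that holds for intervals without break
points holds throughout. -/
theorem interval_induction {P : ℝ → ℝ → Prop} {α β : ℝ} (s : Finset ℝ)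
    (trans : ∀ u w v, α ≤ u → u < w → w < v → v ≤ β → P u w → P w v → P u v)
    (base : ∀ u v, α ≤ u → u < v → v ≤ β → (∀ t ∈ s, t ∉ Ioo u v) → P u v) :
    ∀ u v, α ≤ u → u < v → v ≤ β → P u v := by
  -- Strong induction on the number of break points strictly inside the interval; splitting at one
  -- of them lowers the count on both sides.
  suffices H : ∀ k : ℕ, ∀ u v, (s.filter (· ∈ Ioo u v)).card = k →
      α ≤ u → u < v → v ≤ β → P u v from fun u v => H _ u v rfl
  intro k
  induction k using Nat.strong_induction_on with
  | _ k ih =>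
    intro u v hk hu huv hv
    by_cases h : ∀ t ∈ s, t ∉ Ioo u v
    · exact base u v hu huv hv h
    push Not at h
    obtain ⟨w, hws, hw⟩ := h
    have hmem : w ∈ s.filter (· ∈ Ioo u v) := Finset.mem_filter.2 ⟨hws, hw⟩
    refine trans u w v hu hw.1 hw.2 hv (ih _ ?_ u w rfl hu hw.1 (hw.2.le.trans hv))
      (ih _ ?_ w v rfl (hu.trans hw.1.le) hw.2 hv)
    · rw [← hk]
      refine Finset.card_lt_card (Finset.ssubset_iff_of_subset ?_ |>.2 ⟨w, hmem, by simp⟩)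
      intro t ht
      obtain ⟨h1, h2⟩ := Finset.mem_filter.1 ht
      exact Finset.mem_filter.2 ⟨h1, h2.1, h2.2.trans hw.2⟩
    · rw [← hk]
      refine Finset.card_lt_card (Finset.ssubset_iff_of_subset ?_ |>.2 ⟨w, hmem, by simp⟩)
      intro t ht
      obtain ⟨h1, h2⟩ := Finset.mem_filter.1 ht
      exact Finset.mem_filter.2 ⟨h1, hw.1.trans h2.1, h2.2⟩

/-- The speed of a curve from the right, measured with `ρ`, is given by the induced `F`. -/
theorem tendsto_dist_div (h1 : D1 ρ) (h4 : D4 ρ) (h7 : D7 ρ) {x : ℝ → E n} {t : ℝ} {d : E n}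
    (hx : HasDerivWithinAt x d (Ioi t) t) :
    Tendsto (fun z => ρ (x t) (x z) / (z - t)) (𝓝[>] t) (𝓝 (inducedF ρ (x t) d)) := by
  have hs : Tendsto (slope x t) (𝓝[>] t) (𝓝 d) :=
    (hasDerivWithinAt_iff_tendsto_slope' (by simp)).1 hx
  have hsub : Tendsto (fun z => z - t) (𝓝[>] t) (𝓝[>] 0) := by
    refine tendsto_nhdsWithin_iff.2 ⟨?_, ?_⟩
    · exact ((continuous_id.sub continuous_const).tendsto' t 0 (by simp)).mono_left
        nhdsWithin_le_nhds
    · filter_upwards [self_mem_nhdsWithin] with z hz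
      exact sub_pos.2 (mem_Ioi.1 hz)
  have hT : Tendsto (fun z => ((x t, slope x t z), z - t)) (𝓝[>] t)
      (𝓝 (x t, d) ×ˢ 𝓝[>] 0) := (tendsto_const_nhds.prodMk_nhds hs).prodMk hsub
  refine ((tendsto_quot h1 h4 h7 (x t) d).comp hT).congr fun z => ?_
  simp [quot, sub_smul_slope]

theorem continuousOn_inducedF (h1 : D1 ρ) (h4 : D4 ρ) (h7 : D7 ρ) {x y : ℝ → E n} {s : Set ℝ}
    (hx : ContinuousOn x s) (hy : ContinuousOn y s) :
    ContinuousOn (fun t => inducedF ρ (x t) (y t)) s :=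
  (continuous_inducedF h1 h4 h7).comp_continuousOn (f := fun t => (x t, y t)) (hx.prodMk hy)

/-- By the triangle inequality, the distance from a fixed point grows along the curve at most as
fast as the distance from the current point, whose rate is `F`. -/
theorem eventually_slope_dist_lt (h1 : D1 ρ) (h3 : D3 ρ) (h4 : D4 ρ) (h7 : D7 ρ)
    {x : ℝ → E n} {t r : ℝ} {d : E n} (c : E n) (hx : HasDerivWithinAt x d (Ioi t) t)
    (hr : inducedF ρ (x t) d < r) : ∀ᶠ z in 𝓝[>] t, slope (fun s => ρ c (x s)) t z < r := by
  filter_upwards [(tendsto_dist_div h1 h4 h7 hx).eventually (gt_mem_nhds hr),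
    self_mem_nhdsWithin] with z hz hz'
  have hz0 : 0 < z - t := sub_pos.2 (mem_Ioi.1 hz')
  refine lt_of_le_of_lt ?_ hz
  rw [slope_def_field]
  have := h3 c (x z) (x t)
  exact div_le_div_of_nonneg_right (by linarith) hz0.le

theorem dist_le_integral_of_hasDerivWithinAt (h1 : D1 ρ) (h3 : D3 ρ) (h4 : D4 ρ) (h7 : D7 ρ)
    {x d : ℝ → E n} {G : ℝ → ℝ} {u v : ℝ} (huv : u ≤ v) (hx : ContinuousOn x (Icc u v))
    (hd : ∀ t ∈ Ico u v, HasDerivWithinAt x (d t) (Ioi t) t) (hGc : Continuous G)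
    (hG : ∀ t ∈ Ico u v, G t = inducedF ρ (x t) (d t)) : ρ (x u) (x v) ≤ ∫ t in u..v, G t := by
  have hf : ContinuousOn (fun t => ρ (x u) (x t)) (Icc u v) :=
    h4.1.comp_continuousOn (continuousOn_const.prodMk hx)
  have hB (t : ℝ) : HasDerivAt (fun t => ∫ s in u..t, G s) (G t) t :=
    (hGc.integral_hasStrictDerivAt u t).hasDerivAt
  have h0 : ρ (x u) (x u) ≤ ∫ s in u..u, G s := by simp [h1.self_eq_zero]
  refine image_le_of_liminf_slope_right_le_deriv_boundary hf h0
    (fun t _ => (hB t).continuousAt.continuousWithinAt) (fun t _ => (hB t).hasDerivWithinAt) ?_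
    (right_mem_Icc.2 huv)
  intro t ht r hr
  rw [hG t ht] at hr
  exact (eventually_slope_dist_lt h1 h3 h4 h7 (x u) (hd t ht) hr).frequently

theorem dist_le_integral_of_contDiffOn (h1 : D1 ρ) (h3 : D3 ρ) (h4 : D4 ρ) (h7 : D7 ρ)
    {x : ℝ → E n} {u v : ℝ} (huv : u < v) (hx : ContDiffOn ℝ 1 x (Icc u v)) :
    IntervalIntegrable (fun t => inducedF ρ (x t) (deriv x t)) MeasureTheory.volume u v ∧
      ρ (x u) (x v) ≤ ∫ t in u..v, inducedF ρ (x t) (deriv x t) := by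
  have hdc : ContinuousOn (derivWithin x (Icc u v)) (Icc u v) :=
    hx.continuousOn_derivWithin (uniqueDiffOn_Icc huv) le_rfl
  have hg : ContinuousOn (fun t => inducedF ρ (x t) (derivWithin x (Icc u v) t)) (Icc u v) :=
    continuousOn_inducedF h1 h4 h7 hx.continuousOn hdc
  -- `deriv` may be wrong at the end points, so the integrand is replaced by the one with
  -- `derivWithin`, extended to a continuous function on `ℝ`; the two agree in the open interval.
  obtain ⟨G, hGc, hGe⟩ : ∃ G : ℝ → ℝ, Continuous G ∧
      ∀ t ∈ Icc u v, G t = inducedF ρ (x t) (derivWithin x (Icc u v) t) :=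
    ⟨_, hg.domRestrict.Icc_extend' (h := huv.le), fun t ht => by rw [IccExtend_of_mem _ _ ht]; rfl⟩
  have heq : EqOn G (fun t => inducedF ρ (x t) (deriv x t)) (uIoo u v) := by
    intro t ht
    rw [uIoo_of_le huv.le] at ht
    rw [hGe t (Ioo_subset_Icc_self ht), derivWithin_of_mem_nhds (Icc_mem_nhds ht.1 ht.2)]
  refine ⟨(hGc.intervalIntegrable u v).congr_uIoo heq, ?_⟩
  rw [← intervalIntegral.integral_congr_uIoo heq]
  refine dist_le_integral_of_hasDerivWithinAt h1 h3 h4 h7 huv.le hx.continuousOn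
    (fun t ht => ?_) hGc fun t ht => hGe t (Ico_subset_Icc_self ht)
  have hmem : Icc u v ∈ 𝓝[>] t :=
    mem_of_superset (Ioo_mem_nhdsGT ht.2) fun z hz => ⟨ht.1.trans hz.1.le, hz.2.le⟩
  exact (hx.differentiableOn one_ne_zero t
    (Ico_subset_Icc_self ht)).hasDerivWithinAt.mono_of_mem_nhdsWithin hmem

theorem IsPiecewiseC1.dist_le_integral (h1 : D1 ρ) (h3 : D3 ρ) (h4 : D4 ρ) (h7 : D7 ρ)
    {x : ℝ → E n} {α β : ℝ} (hx : IsPiecewiseC1 x α β) :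
    ∀ u v, α ≤ u → u < v → v ≤ β →
      IntervalIntegrable (fun t => inducedF ρ (x t) (deriv x t)) MeasureTheory.volume u v ∧
      ρ (x u) (x v) ≤ ∫ t in u..v, inducedF ρ (x t) (deriv x t) := by
  obtain ⟨-, s, hs⟩ := hx
  refine interval_induction s ?_ ?_
  · rintro u w v - - - - ⟨i1, l1⟩ ⟨i2, l2⟩
    refine ⟨i1.trans i2, ?_⟩
    rw [← intervalIntegral.integral_add_adjacent_intervals i1 i2]
    exact (h3 _ _ (x w)).trans (add_le_add l1 l2)
  · exact fun u v hu huv hv h => dist_le_integral_of_contDiffOn h1 h3 h4 h7 huv (hs u v hu huv hv h)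

theorem Connects.dist_le_finslerLength (h1 : D1 ρ) (h3 : D3 ρ) (h4 : D4 ρ) (h7 : D7 ρ)
    {x : ℝ → E n} {α β : ℝ} {a b : E n} (hx : Connects x α β a b) :
    ρ a b ≤ finslerLength (inducedF ρ) x α β := by
  obtain ⟨hαβ, hp, rfl, rfl⟩ := hx
  exact (hp.dist_le_integral h1 h3 h4 h7 α β le_rfl hαβ le_rfl).2

theorem Connects.finslerDist_le (h1 : D1 ρ) (h3 : D3 ρ) (h4 : D4 ρ) (h7 : D7 ρ)
    {x : ℝ → E n} {α β : ℝ} {a b : E n} (hx : Connects x α β a b) :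
    finslerDist (inducedF ρ) a b ≤ finslerLength (inducedF ρ) x α β := by
  refine csInf_le ⟨ρ a b, ?_⟩ ⟨x, α, β, hx, rfl⟩
  rintro l ⟨y, γ, δ, hy, rfl⟩
  exact hy.dist_le_finslerLength h1 h3 h4 h7

theorem dist_le_finslerDist (h1 : D1 ρ) (h3 : D3 ρ) (h4 : D4 ρ) (h7 : D7 ρ)
    (hgeo : HasGeodesics (inducedF ρ)) (a b : E n) : ρ a b ≤ finslerDist (inducedF ρ) a b := by
  obtain ⟨x, α, β, hx, hl⟩ := hgeo a b
  exact hl ▸ hx.dist_le_finslerLength h1 h3 h4 h7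

theorem IsPiecewiseC1.concat {x y : ℝ → E n} {α β γ δ : ℝ} (hx : IsPiecewiseC1 x α β)
    (hy : IsPiecewiseC1 y γ δ) (hαβ : α < β) (hγδ : γ < δ) (hxy : x β = y γ) :
    IsPiecewiseC1 (fun t => if t ≤ β then x t else y (t - (β - γ))) α (β + (δ - γ)) := by
  obtain ⟨hxc, s, hs⟩ := hx
  obtain ⟨hyc, s', hs'⟩ := hy
  set z : ℝ → E n := fun t => if t ≤ β then x t else y (t - (β - γ)) with hz
  have e1 : EqOn z x (Iic β) := fun t ht => if_pos ht
  have e2 : EqOn z (fun t => y (t - (β - γ))) (Ici β) := by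
    intro t ht
    rcases (mem_Ici.1 ht).eq_or_lt with rfl | hlt
    · simp [hz, hxy]
    · simp [hz, not_le.2 hlt]
  refine ⟨?_, insert β (s ∪ s'.image (· + (β - γ))), ?_⟩
  · rw [← Icc_union_Icc_eq_Icc hαβ.le (by linarith : β ≤ β + (δ - γ))]
    refine ContinuousOn.union_of_isClosed (hxc.congr fun t ht => e1 ht.2) ?_ isClosed_Icc isClosed_Icc
    refine ContinuousOn.congr (f := fun t => y (t - (β - γ))) ?_ fun t ht => e2 ht.1
    exact hyc.comp (by fun_prop) fun t ht => ⟨by linarith [ht.1], by linarith [ht.2]⟩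
  · intro u v hu huv hv h
    have hβ := h β (by simp)
    rcases le_or_gt v β with hvβ | hvβ
    · refine (hs u v hu huv hvβ fun t ht => h t (by simp [ht])).congr fun t ht => ?_
      exact e1 (ht.2.trans hvβ)
    · have huβ : β ≤ u := by
        by_contra! hlt
        exact hβ ⟨hlt, hvβ⟩
      have hc := hs' (u - (β - γ)) (v - (β - γ)) (by linarith) (by linarith) (by linarith)
        fun t ht hm => h (t + (β - γ))
          (Finset.mem_insert_of_mem (Finset.mem_union_right _ (Finset.mem_image_of_mem _ ht)))
          ⟨by linarith [hm.1], by linarith [hm.2]⟩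
      refine ContDiffOn.congr (f := fun t => y (t - (β - γ))) ?_ fun t ht => e2 (huβ.trans ht.1)
      refine hc.comp (t := Icc (u - (β - γ)) (v - (β - γ))) (g := y) (by fun_prop) fun t ht => ?_
      exact ⟨by linarith [ht.1], by linarith [ht.2]⟩

/-- Minimizing geodesics are concatenated, so no `ε` is lost. The lengths add up by translation
invariance of the integral. -/
theorem finslerDist_triangle (h1 : D1 ρ) (h3 : D3 ρ) (h4 : D4 ρ) (h7 : D7 ρ)
    (hgeo : HasGeodesics (inducedF ρ)) (a b c : E n) :
    finslerDist (inducedF ρ) a c ≤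
      finslerDist (inducedF ρ) a b + finslerDist (inducedF ρ) b c := by
  obtain ⟨x, α, β, ⟨hαβ, hx, hxa, hxb⟩, hlx⟩ := hgeo a b
  obtain ⟨y, γ, δ, ⟨hγδ, hy, hyb, hyc⟩, hly⟩ := hgeo b c
  set z : ℝ → E n := fun t => if t ≤ β then x t else y (t - (β - γ)) with hz
  have hp : IsPiecewiseC1 z α (β + (δ - γ)) := hx.concat hy hαβ hγδ (hxb.trans hyb.symm)
  have hlt : ¬ β + (δ - γ) ≤ β := by linarith
  have hcon : Connects z α (β + (δ - γ)) a c := by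
    refine ⟨by linarith, hp, ?_, ?_⟩
    · simp [hz, hαβ.le, hxa]
    · simp only [hz, hlt, if_false]
      rw [← hyc]
      congr 1
      ring
  refine (hcon.finslerDist_le h1 h3 h4 h7).trans (le_of_eq ?_)
  have i1 := (hp.dist_le_integral h1 h3 h4 h7 α β le_rfl hαβ (by linarith)).1
  have i2 := (hp.dist_le_integral h1 h3 h4 h7 β (β + (δ - γ)) hαβ.le (by linarith) le_rfl).1
  rw [← hlx, ← hly]
  unfold finslerLength
  rw [← intervalIntegral.integral_add_adjacent_intervals i1 i2]
  congr 1
  · refine intervalIntegral.integral_congr_Ioo_of_le hαβ.le fun t ht => ?_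
    have he : z =ᶠ[𝓝 t] x := by
      filter_upwards [Iio_mem_nhds ht.2] with r hr
      exact if_pos (le_of_lt hr)
    simp only [he.deriv_eq, he.eq_of_nhds]
  · have e : ∫ t in β..(β + (δ - γ)), inducedF ρ (z t) (deriv z t) =
        ∫ t in β..(β + (δ - γ)),
          (fun t => inducedF ρ (y t) (deriv y t)) (t - (β - γ)) := by
      refine intervalIntegral.integral_congr_Ioo_of_le (by linarith) fun t ht => ?_
      have he : z =ᶠ[𝓝 t] fun r => y (r - (β - γ)) := by
        filter_upwards [Ioi_mem_nhds ht.1] with r hr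
        exact if_neg (not_le.2 hr)
      simp only [he.deriv_eq, he.eq_of_nhds, deriv_comp_sub_const]
    rw [e, intervalIntegral.integral_comp_sub_right (fun t => inducedF ρ (y t) (deriv y t))]
    congr 1 <;> ring

/-- The Finsler length of a segment. -/
theorem finslerDist_le_segment (h1 : D1 ρ) (h3 : D3 ρ) (h4 : D4 ρ) (h7 : D7 ρ) (a b : E n) :
    finslerDist (inducedF ρ) a b ≤ ∫ t in (0 : ℝ)..1, inducedF ρ (a + t • (b - a)) (b - a) := by
  have hsm : ContDiff ℝ 1 fun t : ℝ => a + t • (b - a) := by fun_prop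
  have hcon : Connects (fun t : ℝ => a + t • (b - a)) 0 1 a b :=
    ⟨one_pos, ⟨hsm.continuous.continuousOn, ∅, fun _ _ _ _ _ _ => hsm.contDiffOn⟩,
      by simp, by simp⟩
  refine (hcon.finslerDist_le h1 h3 h4 h7).trans (le_of_eq ?_)
  unfold finslerLength
  congr 1
  funext t
  have : HasDerivAt (fun t : ℝ => a + t • (b - a)) (b - a) t := by
    simpa using ((hasDerivAt_id t).smul_const (b - a)).const_add a
  rw [this.deriv]

/-- Close to a direction `w` at `p`, the difference quotients of `ρ` almost dominate `F`. -/
theorem eventually_inducedF_le_quot (h1 : D1 ρ) (h4 : D4 ρ) (h7 : D7 ρ) {p w : E n} {ε : ℝ}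
    (hε : 0 < ε) (hF0 : 0 < inducedF ρ p w) :
    ∀ᶠ c : (E n × E n × ℝ) × E n in 𝓝 ((p, p, (0 : ℝ)), w),
      0 < c.1.2.2 → inducedF ρ c.1.1 c.2 ≤ (1 + ε) * quot ρ ((c.1.2.1, c.2), c.1.2.2) := by
  -- Positivity of `F` leaves room for `m`, which separates the nearby values of `F` from `1 + ε`
  -- times the nearby quotients. The base points of the two sides vary independently.
  obtain ⟨m, hm1, hm2⟩ : ∃ m, inducedF ρ p w < m ∧ m < (1 + ε) * inducedF ρ p w :=
    exists_between (by nlinarith)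
  have c1 : Continuous fun c : (E n × E n × ℝ) × E n => (c.1.1, c.2) := by fun_prop
  have c2 : Continuous fun c : (E n × E n × ℝ) × E n => (c.1.2.1, c.2) := by fun_prop
  have c3 : Continuous fun c : (E n × E n × ℝ) × E n => c.1.2.2 := by fun_prop
  have hA : ∀ᶠ z : E n × E n in 𝓝 (p, w), inducedF ρ z.1 z.2 < m :=
    ((continuous_inducedF h1 h4 h7).tendsto (p, w)).eventually (gt_mem_nhds hm1)
  have hB : ∀ᶠ z in 𝓝 (p, w) ×ˢ 𝓝[>] (0 : ℝ), m < (1 + ε) * quot ρ z :=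
    ((tendsto_quot h1 h4 h7 p w).const_mul (1 + ε)).eventually (lt_mem_nhds hm2)
  obtain ⟨P, hP, Q, hQ, H⟩ := eventually_prod_iff.1 hB
  rw [eventually_nhdsWithin_iff] at hQ
  filter_upwards [(c1.tendsto ((p, p, (0 : ℝ)), w)).eventually hA,
    (c2.tendsto ((p, p, (0 : ℝ)), w)).eventually hP,
    (c3.tendsto ((p, p, (0 : ℝ)), w)).eventually hQ] with c hc1 hc2 hc3 hr
  exact (hc1.trans (H hc2 (hc3 hr))).le

/-- Near each point, the Finsler distance is at most slightly larger than `ρ`, if `F` is positive. -/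
theorem eventually_finslerDist_le (h1 : D1 ρ) (h3 : D3 ρ) (h4 : D4 ρ) (h7 : D7 ρ)
    (hpos : ∀ x y : E n, y ≠ 0 → 0 < inducedF ρ x y) (p : E n) {ε : ℝ} (hε : 0 < ε) :
    ∃ δ > 0, ∀ x ∈ Metric.ball p δ, ∀ x' ∈ Metric.ball p δ,
      finslerDist (inducedF ρ) x x' ≤ (1 + ε) * ρ x x' := by
  -- Compactness of the unit sphere makes the comparison uniform in the direction, so it holds along
  -- the whole segment from `x` to `x'`.
  have key : ∀ᶠ c : E n × E n × ℝ in 𝓝 (p, p, (0 : ℝ)), ∀ w ∈ Metric.sphere (0 : E n) 1,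
      0 < c.2.2 → inducedF ρ c.1 w ≤ (1 + ε) * quot ρ ((c.2.1, w), c.2.2) := by
    refine (isCompact_sphere (0 : E n) 1).eventually_forall_of_forall_eventually fun w hw => ?_
    refine eventually_inducedF_le_quot h1 h4 h7 hε (hpos p w ?_)
    rintro rfl
    simp at hw
  obtain ⟨δ, hδ, hball⟩ := Metric.eventually_nhds_iff_ball.1 key
  refine ⟨δ / 2, half_pos hδ, fun x hx x' hx' => ?_⟩
  refine (finslerDist_le_segment h1 h3 h4 h7 x x').trans ?_
  rcases eq_or_ne x x' with rfl | hne
  · simp [inducedF_zero h1, h1.self_eq_zero]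
  have hd0 : 0 < ‖x' - x‖ := norm_pos_iff.2 (sub_ne_zero.2 hne.symm)
  set w := ‖x' - x‖⁻¹ • (x' - x) with hw
  have hws : w ∈ Metric.sphere (0 : E n) 1 := by simp [hw, norm_smul, hd0.ne']
  have hwx : ‖x' - x‖ • w = x' - x := by
    rw [hw, smul_smul, mul_inv_cancel₀ hd0.ne', one_smul]
  have hdδ : ‖x' - x‖ < δ := by
    rw [← dist_eq_norm]
    linarith [dist_triangle_right x' x p, Metric.mem_ball.1 hx, Metric.mem_ball.1 hx']
  have hbound : ∀ t ∈ Icc (0 : ℝ) 1, inducedF ρ (x + t • (x' - x)) (x' - x) ≤ (1 + ε) * ρ x x' := by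
    intro t ht
    have hmem : x + t • (x' - x) ∈ Metric.ball p (δ / 2) :=
      (convex_ball p (δ / 2)).add_smul_sub_mem hx hx' ht
    have h := hball (x + t • (x' - x), x, ‖x' - x‖) (by
      simp only [Metric.mem_ball, Prod.dist_eq, max_lt_iff, dist_zero_right, norm_norm]
      exact ⟨(Metric.mem_ball.1 hmem).trans (by linarith),
        (Metric.mem_ball.1 hx).trans (by linarith), hdδ⟩) w hws hd0
    simp only [quot, hwx, add_sub_cancel] at h
    rw [← hwx, inducedF_smul h1 h4 h7 _ _ hd0, hwx]
    calc ‖x' - x‖ * inducedF ρ (x + t • (x' - x)) w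
        ≤ ‖x' - x‖ * ((1 + ε) * (ρ x x' / ‖x' - x‖)) := by gcongr
      _ = (1 + ε) * ρ x x' := by field_simp
  have hcont : ContinuousOn (fun t : ℝ => inducedF ρ (x + t • (x' - x)) (x' - x)) (uIcc 0 1) :=
    continuousOn_inducedF h1 h4 h7 (by fun_prop) continuousOn_const
  calc _ ≤ ∫ _ in (0 : ℝ)..1, (1 + ε) * ρ x x' :=
        intervalIntegral.integral_mono_on zero_le_one hcont.intervalIntegrable
          (continuous_const.intervalIntegrable _ _) hbound
    _ = _ := by simp

/-! ### Distance spheres -/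

/-- Radial coordinates about `p` in which `ρ p` is the norm. -/
theorem D5c.exists_radial (h1 : D1 ρ) (h5 : D5c ρ) (p : E n) :
    ∃ Φ Ψ : E n → E n, (∀ q, q ≠ p → Φ q ≠ 0 ∧ Ψ (Φ q) = q ∧ ‖Φ q‖ = ρ p q) ∧
      (∀ w, w ≠ 0 → ρ p (Ψ w) = ‖w‖) ∧ ∀ w, w ≠ 0 → ContDiffAt ℝ ∞ Ψ w := by
  obtain ⟨Φ, Ψ, hΦ, hΨ, hinv, -, hΨs, hsph⟩ := h5 p
  have hnorm : ∀ q, q ≠ p → ‖Φ q‖ = ρ p q := by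
    intro q hq
    have : Φ q ∈ Metric.sphere (0 : E n) (ρ p q) := by
      rw [← hsph _ (h1.pos hq.symm)]
      exact mem_image_of_mem Φ rfl
    simpa using this
  refine ⟨Φ, Ψ, fun q hq => ⟨hΦ hq, hinv.1 hq, hnorm q hq⟩, fun w hw => ?_, fun w hw => ?_⟩
  · rw [← hnorm _ (hΨ hw), hinv.2 hw]
  · exact hΨs.contDiffAt (isOpen_compl_singleton.mem_nhds hw)

/-- Moving radially outward from `z` in the coordinates of (D5)(c) increases the distance from `p`
at once, so a point of the sphere is not interior to the closed ball. -/
theorem not_cball_mem_nhds (h1 : D1 ρ) (h5 : D5c ρ) {p z : E n} (hz : z ≠ p) :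
    cball ρ p (ρ p z) ∉ 𝓝 z := by
  intro hmem
  obtain ⟨Φ, Ψ, hΦ, hΨ, hs⟩ := h5.exists_radial h1 p
  obtain ⟨h0, hinv, hn⟩ := hΦ z hz
  have hcurve : Tendsto (fun s : ℝ => Ψ (s • Φ z)) (𝓝[>] 1) (𝓝 z) := by
    have h : ContinuousAt (fun s : ℝ => Ψ (s • Φ z)) 1 :=
      ContinuousAt.comp (f := fun s : ℝ => s • Φ z) (by simpa using (hs _ h0).continuousAt)
        (by fun_prop)
    have h' := h.tendsto
    rw [one_smul, hinv] at h'
    exact h'.mono_left nhdsWithin_le_nhds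
  obtain ⟨s, hs1, hs2⟩ := ((hcurve.eventually hmem).and self_mem_nhdsWithin).exists
  replace hs2 : 1 < s := hs2
  have hs1 : ρ p (Ψ (s • Φ z)) ≤ ρ p z := hs1
  rw [hΨ _ (smul_ne_zero (by linarith) h0), norm_smul, Real.norm_of_nonneg (by linarith), hn] at hs1
  nlinarith [h1.pos hz.symm]

theorem isCompact_sph_and_nonempty (h1 : D1 ρ) (h5 : D5c ρ) (p : E n) [Nontrivial (E n)] {r : ℝ}
    (hr : 0 ≤ r) : IsCompact (sph ρ p r) ∧ (sph ρ p r).Nonempty := by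
  rcases hr.eq_or_lt with rfl | hr
  · have : sph ρ p 0 = {p} := by
      ext q
      simpa [sph, eq_comm] using (h1 p q).2
    rw [this]
    exact ⟨isCompact_singleton, singleton_nonempty p⟩
  obtain ⟨Φ, Ψ, hΦ, hΨ, hs⟩ := h5.exists_radial h1 p
  have hne : ∀ w ∈ Metric.sphere (0 : E n) r, w ≠ 0 := by
    rintro w hw rfl
    simp [hr.ne] at hw
  have himg : sph ρ p r = Ψ '' Metric.sphere 0 r := by
    ext q
    constructor
    · intro hq
      have hqr : ρ p q = r := hq
      have hqp : q ≠ p := by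
        rintro rfl
        rw [h1.self_eq_zero] at hqr
        exact hr.ne hqr
      obtain ⟨-, hinv, hn⟩ := hΦ q hqp
      exact ⟨Φ q, by simp [hn, hqr], hinv⟩
    · rintro ⟨w, hw, rfl⟩
      have := hΨ w (hne w hw)
      rw [mem_sphere_zero_iff_norm.1 hw] at this
      exact this
  rw [himg]
  exact ⟨(isCompact_sphere _ _).image_of_continuousOn
    fun w hw => (hs w (hne w hw)).continuousAt.continuousWithinAt,
    (NormedSpace.sphere_nonempty.2 hr.le).image _⟩

theorem exists_isOscCurve (h1 : D1 ρ) (h4 : D4 ρ) (h5 : D5c ρ) {a b : E n} (hab : a ≠ b) :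
    ∃ o, IsOscCurve ρ a b o := by
  have : Nontrivial (E n) := ⟨⟨a, b, hab⟩⟩
  have hc : Continuous fun p => ρ p b :=
    h4.1.comp (by fun_prop : Continuous fun p : E n => (p, b))
  have hmin : ∀ r : ℝ, ∃ p, 0 ≤ r → p ∈ sph ρ a r ∧ IsMinOn (fun p => ρ p b) (sph ρ a r) p := by
    intro r
    by_cases hr : 0 ≤ r
    · obtain ⟨hk, hne⟩ := isCompact_sph_and_nonempty h1 h5 a hr
      obtain ⟨p, hp, hp'⟩ := hk.exists_isMinOn hne hc.continuousOn
      exact ⟨p, fun _ => ⟨hp, hp'⟩⟩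
    · exact ⟨a, fun h => absurd h hr⟩
  have hmax : ∀ r : ℝ, ∃ p, 0 ≤ r → p ∈ sph ρ a r ∧ IsMaxOn (fun p => ρ p b) (sph ρ a r) p := by
    intro r
    by_cases hr : 0 ≤ r
    · obtain ⟨hk, hne⟩ := isCompact_sph_and_nonempty h1 h5 a hr
      obtain ⟨p, hp, hp'⟩ := hk.exists_isMaxOn hne hc.continuousOn
      exact ⟨p, fun _ => ⟨hp, hp'⟩⟩
    · exact ⟨a, fun h => absurd h hr⟩
  choose f hf using hmin
  choose g hg using hmax
  have hz : ∀ p, p ∈ sph ρ a 0 → p = a := fun p hp => ((h1 a p).2.1 hp).symm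
  refine ⟨fun r => if 0 ≤ r then f r else g (-r), fun r hr => ?_, fun r hr => ?_⟩
  · simpa only [if_pos hr] using hf r hr
  · rcases hr.eq_or_lt with rfl | hr'
    · have e : f 0 = g 0 := (hz _ (hf 0 le_rfl).1).trans (hz _ (hg 0 le_rfl).1).symm
      simpa only [neg_zero, if_pos le_rfl, e] using hg 0 le_rfl
    · simpa only [if_neg (not_le.2 (neg_neg_of_pos hr')), neg_neg] using hg r hr

/-- A point between `a` and `b` is determined by its distances. -/
theorem eq_of_between (h1 : D1 ρ) (h2 : D2 ρ) (h3 : D3 ρ) (h5 : D5a ρ) (h5c : D5c ρ)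
    {a b p q : E n} {r : ℝ} (hp : ρ a p = r) (hq : ρ a q = r) (hpb : ρ p b = ρ a b - r)
    (hqb : ρ q b = ρ a b - r) : p = q := by
  rcases (hp ▸ (h1 a p).1 : 0 ≤ r).eq_or_lt with rfl | hr
  · exact ((h1 a p).2.1 hp).symm.trans ((h1 a q).2.1 hq)
  rcases (hpb ▸ (h1 p b).1 : 0 ≤ ρ a b - r).eq_or_lt with hs | hs
  · rw [← hs] at hpb hqb
    exact ((h1 p b).2.1 hpb).trans ((h1 q b).2.1 hqb).symm
  by_contra hne
  -- By strict convexity the midpoint is interior to the ball about `a`, and by convexity it lies in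
  -- the ball about `b`. The triangle inequality then forces `ρ a z = r`, which puts an interior
  -- point on the sphere.
  set z : E n := (2⁻¹ : ℝ) • p + (2⁻¹ : ℝ) • q with hz
  have hint : z ∈ interior (cball ρ a r) :=
    (h5 a r hr).2 (show ρ a p ≤ r from hp.le) (show ρ a q ≤ r from hq.le) hne
      (by norm_num) (by norm_num) (by norm_num)
  have hzb : ρ b z ≤ ρ a b - r :=
    (h5 b _ hs).2.convex (show ρ b p ≤ ρ a b - r from (h2 b p ▸ hpb).le)
      (show ρ b q ≤ ρ a b - r from (h2 b q ▸ hqb).le) (by norm_num) (by norm_num) (by norm_num)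
  have hza : ρ a z ≤ r := (interior_subset hint : z ∈ cball ρ a r)
  have htri := h3 a b z
  rw [h2 z b] at htri
  have heq : ρ a z = r := le_antisymm hza (by linarith)
  have hzne : z ≠ a := by
    intro h
    rw [h, h1.self_eq_zero] at heq
    exact hr.ne heq
  apply not_cball_mem_nhds h1 h5c hzne
  rw [heq]
  exact mem_interior_iff_mem_nhds.1 hint

/-- Take `η` below the minimum of `ρ p` on the Euclidean sphere of radius `δ`. If `q` were outside,
the segment from `p` to `q` would cross that sphere inside the convex distance ball through `q`. -/
theorem mem_ball_of_dist_lt (h1 : D1 ρ) (h4 : D4 ρ) (h5 : D5a ρ) (p : E n) {δ : ℝ} (hδ : 0 < δ) :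
    ∃ η > 0, ∀ q, ρ p q < η → q ∈ Metric.ball p δ := by
  have hc : Continuous (ρ p) := h4.1.comp (by fun_prop : Continuous fun q : E n => (p, q))
  obtain ⟨η, hη, H⟩ := (isCompact_sphere p δ).exists_forall_le' hc.continuousOn (a := 0) (by
    intro q hq
    refine h1.pos ?_
    rintro rfl
    simp [hδ.ne] at hq)
  refine ⟨η, hη, fun q hq => ?_⟩
  by_contra hnot
  have hd : δ ≤ ‖q - p‖ := by simpa [dist_eq_norm] using hnot
  have hd0 : 0 < ‖q - p‖ := hδ.trans_le hd
  have hpq : p ≠ q := by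
    rintro rfl
    simp at hd0
  have hz : p + (δ / ‖q - p‖) • (q - p) ∈ cball ρ p (ρ p q) :=
    (h5 p _ (h1.pos hpq)).2.convex.add_smul_sub_mem
      (show ρ p p ≤ ρ p q by rw [h1.self_eq_zero]; exact (h1 p q).1) (show ρ p q ≤ ρ p q from le_rfl)
      ⟨by positivity, (div_le_one hd0).2 hd⟩
  have hs : p + (δ / ‖q - p‖) • (q - p) ∈ Metric.sphere p δ := by
    simp [norm_smul, abs_of_pos hδ, hd0.ne']
  exact absurd (H _ hs) (not_le.2 (lt_of_le_of_lt hz hq))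

/-! ### Positivity of the induced Finsler function -/

theorem differentiableAt_dist (h4 : D4 ρ) {a b : E n} (hab : a ≠ b) :
    DifferentiableAt ℝ (ρ a) b := by
  have h : DifferentiableAt ℝ (fun z : E n × E n => ρ z.1 z.2) (a, b) :=
    (h4.2.contDiffAt ((isOpen_ne_fun continuous_fst continuous_snd).mem_nhds hab)).differentiableAt
      (by simp)
  exact DifferentiableAt.comp b (f := fun q : E n => (a, q)) h (by fun_prop)

/-- The differential of the distance from a point does not vanish. -/
theorem exists_fderiv_dist_pos (h1 : D1 ρ) (h4 : D4 ρ) (h5 : D5c ρ) {a b : E n} (hab : a ≠ b) :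
    ∃ e, 0 < fderiv ℝ (ρ a) b e := by
  obtain ⟨Φ, Ψ, hΦ, hΨ, hs⟩ := h5.exists_radial h1 a
  obtain ⟨h0, hinv, hn⟩ := hΦ b hab.symm
  have hcurve : DifferentiableAt ℝ (fun s : ℝ => Ψ (s • Φ b)) 1 :=
    DifferentiableAt.comp (g := Ψ) (f := fun s : ℝ => s • Φ b) 1
      (by simpa using (hs _ h0).differentiableAt (by simp)) (by fun_prop)
  have hb : Ψ ((1 : ℝ) • Φ b) = b := by rw [one_smul, hinv]
  have hf : HasFDerivAt (ρ a) (fderiv ℝ (ρ a) b) (Ψ ((1 : ℝ) • Φ b)) := by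
    rw [hb]
    exact (differentiableAt_dist h4 hab).hasFDerivAt
  have hcomp := hf.comp_hasDerivAt (1 : ℝ) hcurve.hasDerivAt
  -- Along the radial curve through `b` the distance from `a` is linear with slope `ρ a b > 0`.
  have heq : (ρ a ∘ fun s : ℝ => Ψ (s • Φ b)) =ᶠ[𝓝 1] fun s => s * ρ a b := by
    filter_upwards [lt_mem_nhds one_pos] with s hs0
    rw [Function.comp_apply, hΨ _ (smul_ne_zero hs0.ne' h0), norm_smul, hn,
      Real.norm_of_nonneg hs0.le]
  have hlin : HasDerivAt (fun s : ℝ => s * ρ a b) (ρ a b) 1 := by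
    simpa using (hasDerivAt_id (1 : ℝ)).mul_const (ρ a b)
  have := hcomp.unique (hlin.congr_of_eventuallyEq heq)
  exact ⟨_, this ▸ h1.pos hab⟩

theorem tendsto_fderiv_right {f : E n → ℝ} {b : E n} (hf : DifferentiableAt ℝ f b) (v : E n) :
    Tendsto (fun t : ℝ => (f (b + t • v) - f b) / t) (𝓝[>] 0) (𝓝 (fderiv ℝ f b v)) := by
  have h := hf.hasFDerivAt.hasLineDerivAt v
  have h' := (hasDerivAt_iff_tendsto_slope.1 h).mono_left
    (nhdsWithin_mono _ fun t (ht : (0 : ℝ) < t) => ht.ne')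
  refine h'.congr fun t => ?_
  rw [slope_def_field]
  simp

/-- Put `a = b - v` and let `ℓ` be the differential of `ρ a` at `b`. Convexity gives `ℓ(q - b) ≤ 0`
for all `q` in the ball about `a` through `b`. Applied to `q = a + s e` with `ℓ(e) > 0` and small `s
> 0`, this gives `ℓ(v) ≥ s ℓ(e) > 0`, and the triangle inequality gives `F(b, v) ≥ ℓ(v)`. -/
theorem inducedF_pos (h1 : D1 ρ) (h3 : D3 ρ) (h4 : D4 ρ) (h5 : D5a ρ) (h5c : D5c ρ)
    (h7 : D7 ρ) (b v : E n) (hv : v ≠ 0) : 0 < inducedF ρ b v := by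
  set a := b - v with ha
  have hab : a ≠ b := by simpa [ha] using hv
  have hr := h1.pos hab
  have hd := differentiableAt_dist h4 hab
  obtain ⟨e, he⟩ := exists_fderiv_dist_pos h1 h4 h5c hab
  have hsupp : ∀ q ∈ cball ρ a (ρ a b), fderiv ℝ (ρ a) b (q - b) ≤ 0 := by
    intro q hq
    refine le_of_tendsto (tendsto_fderiv_right hd (q - b)) ?_
    filter_upwards [Ioo_mem_nhdsGT (zero_lt_one' ℝ)] with t ht
    have : b + t • (q - b) ∈ cball ρ a (ρ a b) :=
      (h5 a _ hr).2.convex.add_smul_sub_mem (show ρ a b ≤ ρ a b from le_rfl) hq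
        ⟨ht.1.le, ht.2.le⟩
    have : ρ a (b + t • (q - b)) ≤ ρ a b := this
    exact div_nonpos_of_nonpos_of_nonneg (by linarith) ht.1.le
  obtain ⟨s, hs, hs0⟩ : ∃ s : ℝ, a + s • e ∈ cball ρ a (ρ a b) ∧ 0 < s := by
    have hc : Continuous fun s : ℝ => ρ a (a + s • e) :=
      h4.1.comp (by fun_prop : Continuous fun s : ℝ => (a, a + s • e))
    have h0 : ∀ᶠ s : ℝ in 𝓝 0, ρ a (a + s • e) < ρ a b :=
      hc.continuousAt.eventually (gt_mem_nhds (by simpa [h1.self_eq_zero] using hr))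
    obtain ⟨s, hs, hs'⟩ := ((h0.filter_mono nhdsWithin_le_nhds).and
      (self_mem_nhdsWithin : Ioi (0 : ℝ) ∈ 𝓝[>] 0)).exists
    exact ⟨s, le_of_lt hs, hs'⟩
  have h := hsupp _ hs
  rw [show a + s • e - b = s • e - v by rw [ha]; abel, map_sub, map_smul, smul_eq_mul] at h
  have hvpos : 0 < fderiv ℝ (ρ a) b v := by nlinarith [mul_pos hs0 he]
  refine hvpos.trans_le (le_of_tendsto_of_tendsto (tendsto_fderiv_right hd v)
    (tendsto_quot_right h1 h4 h7 b v) ?_)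
  filter_upwards [self_mem_nhdsWithin] with t ht
  have := h3 a (b + t • v) b
  exact div_le_div_of_nonneg_right (by linarith) (le_of_lt ht)

/-! ### Quasigeodesics and the Finsler distance -/

theorem IsOscCurve.apply_zero (h1 : D1 ρ) {a b : E n} {q : ℝ → E n} (hq : IsOscCurve ρ a b q) :
    q 0 = a := ((h1 a (q 0)).2.1 (hq.1 0 le_rfl).1).symm

theorem IsOscCurve.apply_dist (h1 : D1 ρ) {a b : E n} {q : ℝ → E n} (hq : IsOscCurve ρ a b q) :
    q (ρ a b) = b := by
  have h : ρ (q (ρ a b)) b ≤ ρ b b := (hq.1 (ρ a b) (h1 a b).1).2 (show ρ a b = ρ a b from rfl)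
  rw [h1.self_eq_zero] at h
  exact (h1 _ b).2.1 (le_antisymm h (h1 _ _).1)

/-- Fine subdivisions may be chosen to pass through `r` and `r'`, and on each of the three pieces
the sum is at least the distance of the ends. -/
theorem HasDistLength.dist_add_le (h1 : D1 ρ) (h3 : D3 ρ) {x : ℝ → E n} {α β r r' L : ℝ}
    (h : HasDistLength ρ x α β (ENNReal.ofReal L)) (hL : 0 ≤ L) (hr : α ≤ r) (hrr : r ≤ r')
    (hr' : r' ≤ β) : ρ (x α) (x r) + ρ (x r) (x r') + ρ (x r') (x β) ≤ L := by
  by_contra! hlt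
  obtain ⟨δ, hδ, H⟩ := h _ (Iio_mem_nhds ((ENNReal.ofReal_lt_ofReal_iff (hL.trans_lt hlt)).2 hlt))
  obtain ⟨N₁, t₁, ht₁, hm₁⟩ := exists_fine_subdivision hr hδ
  obtain ⟨N₂, t₂, ht₂, hm₂⟩ := exists_fine_subdivision hrr hδ
  obtain ⟨N₃, t₃, ht₃, hm₃⟩ := exists_fine_subdivision hr' hδ
  obtain ⟨u, hu, hu1, hu2⟩ := ht₁.append ht₂
  obtain ⟨w, hw, hw1, hw2⟩ := hu.append ht₃
  have hmu : ∀ i < N₁ + N₂, u (i + 1) - u i < δ := fine_append hu1 hu2 hm₁ hm₂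
  have hmw : ∀ i < N₁ + N₂ + N₃, w (i + 1) - w i < δ := fine_append hw1 hw2 hmu hm₃
  have hlt' : ENNReal.ofReal (polySum ρ x w (N₁ + N₂ + N₃)) < _ :=
    H _ w hw.mono hw.left hw.right hmw
  rw [ENNReal.ofReal_lt_ofReal_iff (hL.trans_lt hlt), polySum_append x N₃ hw1 hw2,
    polySum_append x N₂ hu1 hu2] at hlt'
  linarith [ht₁.dist_le h1 h3 x, ht₂.dist_le h1 h3 x, ht₃.dist_le h1 h3 x]

/-- A quasigeodesic arc whose length is the distance of its end points is isometric to an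
interval. -/
theorem IsOscCurve.dist_eq_of_hasDistLength (h1 : D1 ρ) (h3 : D3 ρ) {a b : E n}
    {q : ℝ → E n} (hq : IsOscCurve ρ a b q)
    (h : HasDistLength ρ q 0 (ρ a b) (ENNReal.ofReal (ρ a b))) {r r' : ℝ} (hr : 0 ≤ r)
    (hrr : r ≤ r') (hr' : r' ≤ ρ a b) : ρ (q r) (q r') = r' - r := by
  have hsum := h.dist_add_le h1 h3 (h1 a b).1 hr hrr hr'
  rw [hq.apply_zero h1, hq.apply_dist h1] at hsum
  have e1 : ρ a (q r) = r := (hq.1 r hr).1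
  have e2 : ρ a (q r') = r' := (hq.1 r' (hr.trans hrr)).1
  have := h3 a b (q r')
  have := h3 a (q r') (q r)
  linarith

theorem hasDistLength_of_dist_eq {x : ℝ → E n} {α β : ℝ}
    (h : ∀ r r', α ≤ r → r ≤ r' → r' ≤ β → ρ (x r) (x r') = r' - r) :
    HasDistLength ρ x α β (ENNReal.ofReal (β - α)) := by
  intro U hU
  refine ⟨1, one_pos, fun N t hm h0 hN _ => ?_⟩
  have ht : IsSubdivision t N α β := ⟨hm, h0, hN⟩
  have : ∑ i ∈ Finset.range N, ρ (x (t i)) (x (t (i + 1))) = β - α := by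
    rw [← h0, ← hN, ← Finset.sum_range_sub t N]
    refine Finset.sum_congr rfl fun i hi => ?_
    have hi' := Finset.mem_range.1 hi
    exact h _ _ (ht.mem_Icc hi'.le).1 (hm (Nat.le_succ i)) (ht.mem_Icc hi').2
  rw [this]
  exact mem_of_mem_nhds hU

theorem dist_eq_of_eq_finslerDist (h1 : D1 ρ) (h2 : D2 ρ) (h3 : D3 ρ) (h4 : D4 ρ) (h5 : D5a ρ)
    (h5c : D5c ρ) (h7 : D7 ρ) (hgeo : HasGeodesics (inducedF ρ))
    (hρ : ρ = finslerDist (inducedF ρ)) {a b : E n} {q : ℝ → E n} (hq : IsOscCurve ρ a b q)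
    {r r' : ℝ} (hr : 0 ≤ r) (hrr : r ≤ r') (hr' : r' ≤ ρ a b) : ρ (q r) (q r') = r' - r := by
  obtain ⟨x, α, β, ⟨hαβ, hx, hxa, hxb⟩, hl⟩ := hgeo a b
  have hl' : ∫ t in α..β, inducedF ρ (x t) (deriv x t) = ρ a b := by
    rw [show ρ a b = finslerDist (inducedF ρ) a b from congrFun (congrFun hρ a) b, ← hl]
    rfl
  have hle : ∀ u v, α ≤ u → u ≤ v → v ≤ β →
      IntervalIntegrable (fun t => inducedF ρ (x t) (deriv x t)) MeasureTheory.volume u v ∧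
      ρ (x u) (x v) ≤ ∫ t in u..v, inducedF ρ (x t) (deriv x t) := by
    intro u v hu huv hv
    rcases huv.eq_or_lt with rfl | hlt
    · simp [h1.self_eq_zero]
    · exact hx.dist_le_integral h1 h3 h4 h7 u v hu hlt hv
  -- The length of the geodesic is exactly `ρ a b` and splits over three subarcs, each at least as
  -- long as its chord.
  have hsum : ∀ u v, α ≤ u → u ≤ v → v ≤ β → ρ a (x u) + ρ (x u) (x v) + ρ (x v) b ≤ ρ a b := by
    intro u v hu huv hv
    obtain ⟨i1, l1⟩ := hle α u le_rfl hu (huv.trans hv)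
    obtain ⟨i2, l2⟩ := hle u v hu huv hv
    obtain ⟨i3, l3⟩ := hle v β (hu.trans huv) hv le_rfl
    rw [hxa] at l1
    rw [hxb] at l3
    rw [← hl', ← intervalIntegral.integral_add_adjacent_intervals (i1.trans i2) i3,
      ← intervalIntegral.integral_add_adjacent_intervals i1 i2]
    linarith
  have hf : ContinuousOn (fun t => ρ a (x t)) (Icc α β) :=
    h4.1.comp_continuousOn (f := fun t => (a, x t)) (continuousOn_const.prodMk hx.1)
  -- The geodesic meets every sphere `S_a(s)`. Its point there is at distance `ρ a b - s` from `b`,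
  -- the least possible, so `q s` has the same two distances and coincides with it.
  have hpt : ∀ s, 0 ≤ s → s ≤ ρ a b → ∃ t ∈ Icc α β, ρ a (x t) = s ∧ q s = x t := by
    intro s hs hs'
    obtain ⟨t, ht, hts⟩ := intermediate_value_Icc hαβ.le hf
      (show s ∈ Icc (ρ a (x α)) (ρ a (x β)) by rw [hxa, hxb, h1.self_eq_zero]; exact ⟨hs, hs'⟩)
    replace hts : ρ a (x t) = s := hts
    have hsm := hsum t t ht.1 le_rfl ht.2
    rw [h1.self_eq_zero, hts] at hsm
    have htri := h3 a b (x t)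
    obtain ⟨hm, hmin⟩ := hq.1 s hs
    have hm' : ρ a (q s) = s := hm
    have hle' : ρ (q s) b ≤ ρ (x t) b := hmin (show ρ a (x t) = s from hts)
    have htri' := h3 a b (q s)
    exact ⟨t, ht, hts, eq_of_between h1 h2 h3 h5 h5c hm' hts (by linarith) (by linarith)⟩
  obtain ⟨t, ht, hts, hqt⟩ := hpt r hr (hrr.trans hr')
  obtain ⟨t', ht', hts', hqt'⟩ := hpt r' (hr.trans hrr) hr'
  rw [hqt, hqt']
  rcases le_total t t' with htt | htt
  · have := hsum t t' ht.1 htt ht'.2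
    have := h3 a b (x t')
    have := h3 a (x t') (x t)
    linarith
  -- If the geodesic parameters come in the reverse order, additivity forces `r = r'` and both
  -- points coincide.
  · have := hsum t' t ht'.1 htt ht.2
    have := h3 a b (x t)
    have hz := (h1 (x t') (x t)).1
    have e0 : ρ (x t') (x t) = 0 := by linarith
    have e1 : r = r' := by linarith
    rw [h2, e0, e1, sub_self]

/-- The Finsler distance is at most `ρ a b` if there is a curve from `a` to `b` that is isometric
to an interval. -/
theorem finslerDist_le_of_isometric (h1 : D1 ρ) (h2 : D2 ρ) (h3 : D3 ρ) (h4 : D4 ρ) (h5 : D5a ρ)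
    (h5c : D5c ρ) (h7 : D7 ρ) (hgeo : HasGeodesics (inducedF ρ)) {q : ℝ → E n} {R : ℝ}
    (hR : 0 ≤ R) (hq : ∀ r r', 0 ≤ r → r ≤ r' → r' ≤ R → ρ (q r) (q r') = r' - r) :
    finslerDist (inducedF ρ) (q 0) (q R) ≤ R := by
  have hq' : ∀ r ∈ Icc 0 R, ∀ r' ∈ Icc 0 R, ρ (q r) (q r') = |r' - r| := by
    intro r hr r' hr'
    rcases le_total r r' with h | h
    · rw [hq r r' hr.1 h hr'.2, abs_of_nonneg (by linarith)]
    · rw [h2, hq r' r hr'.1 h hr.2, abs_of_nonpos (by linarith)]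
      ring
  have hpos := inducedF_pos h1 h3 h4 h5 h5c h7
  have htri := finslerDist_triangle h1 h3 h4 h7 hgeo
  suffices H : ∀ ε > 0, finslerDist (inducedF ρ) (q 0) (q R) ≤ (1 + ε) * R by
    refine le_of_forall_pos_le_add fun ε hε => (H (ε / (R + 1)) (by positivity)).trans ?_
    have : ε / (R + 1) * R ≤ ε := by
      rw [div_mul_eq_mul_div, div_le_iff₀ (by positivity)]
      nlinarith
    linarith
  intro ε hε
  -- The curve `q` is not known to be differentiable, so its Finsler length is unavailable; instead
  -- the growth of `f` is bounded locally by `1 + ε` and compared with a linear function.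
  set f : ℝ → ℝ := fun r => finslerDist (inducedF ρ) (q 0) (q r) with hf
  have hloc : ∀ r ∈ Icc 0 R, ∃ η > 0, ∀ r' ∈ Icc 0 R, |r' - r| < η →
      |f r' - f r| ≤ (1 + ε) * |r' - r| := by
    intro r hr
    obtain ⟨δ, hδ, hD⟩ := eventually_finslerDist_le h1 h3 h4 h7 hpos (q r) hε
    -- The local comparison holds on Euclidean balls, whereas `q` is only controlled in `ρ`.
    obtain ⟨η, hη, hB⟩ := mem_ball_of_dist_lt h1 h4 h5 (q r) hδ
    refine ⟨η, hη, fun r' hr' hlt => ?_⟩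
    have hmem := hB (q r') (by rwa [hq' r hr r' hr'])
    have hself := Metric.mem_ball_self (x := q r) hδ
    have d1 := hD _ hself _ hmem
    have d2 := hD _ hmem _ hself
    rw [hq' r hr r' hr'] at d1
    rw [h2, hq' r hr r' hr'] at d2
    have t1 := htri (q 0) (q r) (q r')
    have t2 := htri (q 0) (q r') (q r)
    rw [abs_le]
    exact ⟨by simp only [hf]; linarith, by simp only [hf]; linarith⟩
  have hcont : ContinuousOn f (Icc 0 R) := by
    intro r hr
    obtain ⟨η, hη, H⟩ := hloc r hr
    refine tendsto_iff_dist_tendsto_zero.2 ?_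
    have hlim : Tendsto (fun r' => (1 + ε) * |r' - r|) (𝓝[Icc 0 R] r) (𝓝 0) :=
      ((by fun_prop : Continuous fun r' : ℝ => (1 + ε) * |r' - r|).tendsto' r 0
        (by simp)).mono_left nhdsWithin_le_nhds
    refine squeeze_zero' (Eventually.of_forall fun _ => dist_nonneg) ?_ hlim
    filter_upwards [self_mem_nhdsWithin, mem_nhdsWithin_of_mem_nhds (Metric.ball_mem_nhds r hη)]
      with r' h h'
    exact H r' h h'
  have h0 : f 0 ≤ (1 + ε) * 0 := by
    obtain ⟨δ, hδ, hD⟩ := eventually_finslerDist_le h1 h3 h4 h7 hpos (q 0) hε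
    have hself := Metric.mem_ball_self (x := q 0) hδ
    simpa [h1.self_eq_zero] using hD _ hself _ hself
  have hB (r : ℝ) : HasDerivAt (fun r => (1 + ε) * r) (1 + ε) r := by
    simpa using (hasDerivAt_id r).const_mul (1 + ε)
  refine image_le_of_liminf_slope_right_le_deriv_boundary hcont h0
    (fun r _ => (hB r).continuousAt.continuousWithinAt) (fun r _ => (hB r).hasDerivWithinAt) ?_
    (right_mem_Icc.2 hR)
  intro r hr c hc
  obtain ⟨η, hη, H⟩ := hloc r (Ico_subset_Icc_self hr)
  refine Eventually.frequently ?_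
  filter_upwards [Ioo_mem_nhdsGT hr.2, Ioo_mem_nhdsGT (lt_add_of_pos_right r hη)] with z hz hz'
  have hz0 : 0 < z - r := sub_pos.2 hz.1
  have := H z ⟨hr.1.trans hz.1.le, hz.2.le⟩ (by rw [abs_of_pos hz0]; linarith [hz'.2])
  rw [abs_of_pos hz0] at this
  rw [slope_def_field, div_lt_iff₀ hz0]
  nlinarith [le_abs_self (f z - f r)]

theorem eq_finslerDist_iff (h1 : D1 ρ) (h2 : D2 ρ) (h3 : D3 ρ) (h4 : D4 ρ) (h5 : D5a ρ)
    (h5c : D5c ρ) (h6 : D6 ρ) (h7 : D7 ρ) (hgeo : HasGeodesics (inducedF ρ)) :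
    ρ = finslerDist (inducedF ρ) ↔ ∀ (a b : E n) (q : ℝ → E n), IsQuasigeodesic ρ a b q →
      HasDistLength ρ q 0 (ρ a b) (ENNReal.ofReal (ρ a b)) := by
  constructor
  · intro hρ a b q hq
    have := hasDistLength_of_dist_eq (ρ := ρ) (x := q) (α := 0) (β := ρ a b) fun r r' =>
      dist_eq_of_eq_finslerDist h1 h2 h3 h4 h5 h5c h7 hgeo hρ hq.2.1
    rwa [sub_zero] at this
  · intro H
    funext a b
    refine le_antisymm (dist_le_finslerDist h1 h3 h4 h7 hgeo a b) ?_
    -- Quasigeodesics require distinct generators, so equal end points are handled by the constant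
    -- segment.
    rcases eq_or_ne a b with rfl | hab
    · have := finslerDist_le_segment h1 h3 h4 h7 a a
      simpa [inducedF_zero h1, h1.self_eq_zero] using this
    obtain ⟨q, hq⟩ := exists_isOscCurve h1 h4 h5c hab
    have hlen := H a b q ⟨hab, hq, h6 a b hab q hq⟩
    have := finslerDist_le_of_isometric h1 h2 h3 h4 h5 h5c h7 hgeo (h1 a b).1 fun r r' =>
      hq.dist_eq_of_hasDistLength h1 h3 hlen
    rwa [hq.apply_zero h1, hq.apply_dist h1] at this

end DistSpace

theorem theorem4 (n : ℕ) (ρ : E n → E n → ℝ) (h1 : D1 ρ) (h2 : D2 ρ) (h3 : D3 ρ) :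
    -- (a) the distance arc length of a curve from `a` to `b` is at least `ρ a b`
    (∀ (x : ℝ → E n) (α β : ℝ) (L : ℝ≥0∞), α ≤ β → HasDistLength ρ x α β L →
      ENNReal.ofReal (ρ (x α) (x β)) ≤ L) ∧
    -- for continuous curves of a differentiable distance space the distance arc length exists in
    -- `[0, ∞]`, and (in positive dimension) it can exceed `ρ a b`
    (D4 ρ →
      (∀ (x : ℝ → E n) (α β : ℝ), α ≤ β → ContinuousOn x (Set.Icc α β) →
        ∃ L : ℝ≥0∞, HasDistLength ρ x α β L) ∧
      (0 < n → ∀ a b : E n, ∃ (x : ℝ → E n) (L : ℝ≥0∞), ContDiff ℝ ∞ x ∧ x 0 = a ∧ x 1 = b ∧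
        HasDistLength ρ x 0 1 L ∧ ENNReal.ofReal (ρ a b) < L)) ∧
    -- (b)
    (D4 ρ → D5a ρ → D5b ρ → D5c ρ → D5d ρ → D6 ρ → D7 ρ → HasGeodesics (inducedF ρ) →
      (ρ = finslerDist (inducedF ρ) ↔
        ∀ (a b : E n) (q : ℝ → E n), IsQuasigeodesic ρ a b q →
          HasDistLength ρ q 0 (ρ a b) (ENNReal.ofReal (ρ a b)))) :=
  ⟨fun _ _ _ _ hαβ h => dist_le_distLength h1 h3 hαβ h,
    fun h4 => ⟨fun _ _ _ _ hx => ⟨_, hasDistLength_supLength h1 h2 h3 h4.1 hx⟩,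
      fun hn a b => exists_curve_longer h1 h2 h3 h4.1 hn a b⟩,
    fun h4 h5a _ h5c _ h6 h7 hgeo => eq_finslerDist_iff h1 h2 h3 h4 h5a h5c h6 h7 hgeo⟩
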